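/- Let $x_1,\dots,x_n$ be self-adjoint operators on a complex Hilbert space which satisfy the canonical commutation relations $[x_j,x_k]=i\theta_{jk}$ in the Weyl form $$e^{iu^{T}x}e^{iv^{T}x}=e^{-iu^{T}\Theta v/2}\,e^{i(u+v)^{T}x},\qquad u,v\in\mathbb R^n,$$ where $\Theta=(\theta_{jk})$ is a real antisymmetric matrix and $u\mapsto e^{iu^Tx}$ is strongly continuous and unitary. Let $\rho$ be a density operator with spectral decomposition $\rho=\sum_i p_i|e_i\rangle\langle e_i|$. Write $\mathbf E A=\mathrm{Tr}(\rho A)=\sum_i p_i\langle e_i, Ae_i\rangle$ and, for symmetric $A$, $\mathbf E(AB)=\sum_i p_i\langle Ae_i,Be_i\rangle$. Let $H$ be a self-adjoint operator with $\mathbf E(H^2)<\infty$, that is, $e_i\in\mathrm{dom}\,H$ whenever $p_i\neq 0$ and $\sum_i p_i\|He_i\|^2<\infty$. Put $\xi=x-\mathbf E x$, $\eta=H-\mathbf E H$ and $$\epsilon_j=\mathrm{Re}\,\mathbf E(\eta\xi_j),\quad \gamma_{jk}=\mathrm{Re}\,\mathbf E(\eta\xi_j\xi_k),\quad \sigma_{jk}=\mathrm{Re}\,\mathbf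 E(\xi_j\xi_k),\quad \tau_{jkl}=\mathrm{Re}\,\mathbf E(\xi_j\xi_k\xi_l),\quad S=\mathbf E(\xi\xi^{T}),$$ $\Sigma=(\sigma_{jk})$, $\Gamma=(\gamma_{jk})$. Let $\mathbb S_n$ be the space of real symmetric matrices of order $n$ with the inner product $\langle X,Y\rangle=\mathrm{Tr}(XY)$, and for $(\alpha,\beta,R)\in\mathbb R\times\mathbb R^n\times\mathbb S_n$ let $$Q(\alpha,\beta,R)=\mathbf E\big((\eta-\alpha-\beta^{T}\xi-\xi^{T}R\xi/2)^2\big).$$ Suppose that the state is Gaussian, that is, $\mathbf E e^{iu^{T}\xi}=e^{-u^{T}\Sigma u/2}$ for all $u\in\mathbb R^n$, and that the quantum covariance matrix $S$ is nonsingular. Then: 1. The operators $\xi_j$, $\xi_j\xi_k$, $\eta$, $\eta-\alpha-\beta^T\xi-\xi^TR\xi/2$ and $H-a-b^Tx-x^TRx/2$ have finite second moments. For all $a\in\mathbb R$, $b\in\mathbb R^n$ and $R\in\mathbb S_n$, with $\mu=\mathbf E x$, $$\mathbf E\big((H-a-b^{T}x-x^{T}Rx/2)^2\big)=Q\big(a+b^{T}\mu+\mu^{T}R\mu/2-\mathbf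 E H,\; b+R\mu,\; R\big).$$ 2. $\tau_{jkl}=0$ for all $j,k,l$. 3. $\Sigma$ is positive definite, $\Gamma\in\mathbb S_n$, and $K(R)=\Sigma R\Sigma+\Theta R\Theta/4$ defines a positive definite self-adjoint operator on $\mathbb S_n$, which is therefore invertible. 4. $Q$ has exactly one minimizer $(\alpha_\diamond,\beta_\diamond,R_\diamond)$ over $\mathbb R\times\mathbb R^n\times\mathbb S_n$, namely $$\alpha_\diamond=-\langle\Sigma,R_\diamond\rangle/2,\qquad \beta_\diamond=\Sigma^{-1}\epsilon,\qquad R_\diamond=K^{-1}(\Gamma).$$ -/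

import Mathlib

open scoped InnerProductSpace

noncomputable section

namespace QuantumQuad

variable {ι 𝓗 : Type*} [NormedAddCommGroup 𝓗] [InnerProductSpace ℂ 𝓗]

/-! ### Unbounded operators

A (possibly unbounded) operator on `𝓗` is a partially defined linear map `𝓗 →ₗ.[ℂ] 𝓗`. Sums,
differences and scalar multiples are Mathlib's, with the natural (intersection) domains. An
observable is a self-adjoint such operator. -/

/-- The identity operator, everywhere defined. -/
def idOp : 𝓗 →ₗ.[ℂ] 𝓗 := (LinearMap.id : 𝓗 →ₗ[ℂ] 𝓗).toPMap ⊤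

/-- The domain of the product `A B`: the vectors `v` of the domain of `B` for which `B v` lies in
the domain of `A`. -/
def mulDomain (A B : 𝓗 →ₗ.[ℂ] 𝓗) : Submodule ℂ 𝓗 where
  carrier := {v | ∃ h : v ∈ B.domain, B ⟨v, h⟩ ∈ A.domain}
  zero_mem' := ⟨B.domain.zero_mem, by
    have h : B ⟨0, B.domain.zero_mem⟩ = 0 := B.map_zero
    rw [h]; exact A.domain.zero_mem⟩
  add_mem' := by
    rintro a b ⟨ha, ha'⟩ ⟨hb, hb'⟩
    refine ⟨B.domain.add_mem ha hb, ?_⟩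
    have h : B ⟨a + b, B.domain.add_mem ha hb⟩ = B ⟨a, ha⟩ + B ⟨b, hb⟩ :=
      B.map_add ⟨a, ha⟩ ⟨b, hb⟩
    rw [h]; exact A.domain.add_mem ha' hb'
  smul_mem' := by
    rintro c a ⟨ha, ha'⟩
    refine ⟨B.domain.smul_mem c ha, ?_⟩
    have h : B ⟨c • a, B.domain.smul_mem c ha⟩ = c • B ⟨a, ha⟩ := B.map_smul c ⟨a, ha⟩
    rw [h]; exact A.domain.smul_mem c ha'

/-- The product `A B` of two operators, on its natural domain. -/
def mulOp (A B : 𝓗 →ₗ.[ℂ] 𝓗) : 𝓗 →ₗ.[ℂ] 𝓗 where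
  domain := mulDomain A B
  toFun :=
    { toFun := fun v => A ⟨B ⟨v.1, v.2.1⟩, v.2.2⟩
      map_add' := by
        rintro ⟨a, ha, ha'⟩ ⟨b, hb, hb'⟩
        rw [← A.map_add]
        congr 1
        exact Subtype.ext (B.map_add ⟨a, ha⟩ ⟨b, hb⟩)
      map_smul' := by
        rintro c ⟨a, ha, ha'⟩
        rw [RingHom.id_apply, ← A.map_smul]
        congr 1
        exact Subtype.ext (B.map_smul c ⟨a, ha⟩) }

open Classical in
/-- The value `A v` for `v` in the domain of `A` (and `0` outside of it; all the vectors at which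
this is used with a nonzero weight are required or proved to lie in the domain). -/
def app (A : 𝓗 →ₗ.[ℂ] 𝓗) (v : 𝓗) : 𝓗 := if h : v ∈ A.domain then A ⟨v, h⟩ else 0

/-- The quadratic polynomial `a + bᵀ y + yᵀ R y / 2` of a vector `y` of operators. -/
def quadOp {n : ℕ} (y : Fin n → 𝓗 →ₗ.[ℂ] 𝓗) (a : ℝ) (b : Fin n → ℝ)
    (R : Matrix (Fin n) (Fin n) ℝ) : 𝓗 →ₗ.[ℂ] 𝓗 :=
  (a : ℂ) • idOp + ∑ j, (b j : ℂ) • y j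
    + (1 / 2 : ℂ) • ∑ j, ∑ k, (R j k : ℂ) • mulOp (y j) (y k)

/-- The canonical commutation relations `[x_j, x_k] = i θ_{jk}` in Weyl (exponentiated) form.
Here `W u = exp (i uᵀ x)`: these are unitary operators, strongly continuous in `u`, with
`exp (i uᵀ x) exp (i vᵀ x) = exp (- i uᵀ Θ v / 2) exp (i (u + v)ᵀ x)`, and `i x_j` is the
derivative at `0` of the one-parameter group `t ↦ W (t e_j)` (for a self-adjoint `x_j` this says
precisely that `W (t e_j) = exp (i t x_j)`). -/
structure IsWeylSystem {n : ℕ} (x : Fin n → 𝓗 →ₗ.[ℂ] 𝓗) (Θ : Matrix (Fin n) (Fin n) ℝ)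
    (W : (Fin n → ℝ) → 𝓗 →L[ℂ] 𝓗) : Prop where
  norm_map : ∀ u v, ‖W u v‖ = ‖v‖
  surjective : ∀ u, Function.Surjective (W u)
  continuous : ∀ v, Continuous fun u => W u v
  weyl : ∀ u u' v, W u (W u' v)
    = Complex.exp (-(Complex.I * ((u ⬝ᵥ Θ.mulVec u' : ℝ) : ℂ) / 2)) • W (u + u') v
  hasDerivAt : ∀ j, ∀ v : (x j).domain,
    HasDerivAt (fun t : ℝ => W (t • Pi.single j 1) (v : 𝓗)) (Complex.I • x j v) 0

/-! ### Quantum states and expectations -/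

/-- A density operator (positive, of trace one) together with a spectral decomposition: an
orthonormal basis of eigenvectors with eigenvalues `prob i ≥ 0` of sum `1`. -/
structure DensityOperator (ι 𝓗 : Type*) [NormedAddCommGroup 𝓗] [InnerProductSpace ℂ 𝓗] where
  op : 𝓗 →L[ℂ] 𝓗
  basis : HilbertBasis ι ℂ 𝓗
  prob : ι → ℝ
  prob_nonneg : ∀ i, 0 ≤ prob i
  hasSum_prob : HasSum prob 1
  op_basis : ∀ i, op (basis i) = (prob i : ℂ) • basis i

namespace DensityOperator

variable (ρ : DensityOperator ι 𝓗)

/-- The expectation `𝐄 A = Tr (ρ A)`, evaluated in the eigenbasis of `ρ`. -/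
def expect (A : 𝓗 →ₗ.[ℂ] 𝓗) : ℂ :=
  ∑' i, (ρ.prob i : ℂ) * ⟪ρ.basis i, app A (ρ.basis i)⟫_ℂ

/-- The expectation `𝐄 (A B) = Tr (ρ A B) = ∑ i, prob i * ⟨e_i, A B e_i⟩` of the product of a
symmetric operator `A` and an operator `B`, in the form `∑ i, prob i * ⟨A e_i, B e_i⟩`, which
makes sense as soon as `A` and `B` have finite second moments. -/
def expectMul (A B : 𝓗 →ₗ.[ℂ] 𝓗) : ℂ :=
  ∑' i, (ρ.prob i : ℂ) * ⟪app A (ρ.basis i), app B (ρ.basis i)⟫_ℂ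

/-- The mean square `𝐄 (A²)` of a symmetric operator `A`. -/
def meanSq (A : 𝓗 →ₗ.[ℂ] 𝓗) : ℝ := ∑' i, ρ.prob i * ‖app A (ρ.basis i)‖ ^ 2

/-- `A` is square summable with respect to `ρ`. -/
def FiniteSecondMoment (A : 𝓗 →ₗ.[ℂ] 𝓗) : Prop :=
  (∀ i, ρ.prob i ≠ 0 → ρ.basis i ∈ A.domain) ∧
    Summable fun i => ρ.prob i * ‖app A (ρ.basis i)‖ ^ 2

/-- The centered operator `A - 𝐄 A`. -/
def centered (A : 𝓗 →ₗ.[ℂ] 𝓗) : 𝓗 →ₗ.[ℂ] 𝓗 := A - ρ.expect A • idOp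

section moments

variable {n : ℕ} (x : Fin n → 𝓗 →ₗ.[ℂ] 𝓗) (H : 𝓗 →ₗ.[ℂ] 𝓗)

/-- The mean vector `𝐄 x`. -/
def meanVec : Fin n → ℝ := fun j => (ρ.expect (x j)).re

/-- The centered observables `ξ = x - 𝐄 x`. -/
def xi : Fin n → 𝓗 →ₗ.[ℂ] 𝓗 := fun j => ρ.centered (x j)

/-- The centered Hamiltonian `η = H - 𝐄 H`. -/
def eta : 𝓗 →ₗ.[ℂ] 𝓗 := ρ.centered H

/-- The quantum covariance matrix `S = 𝐄 (ξ ξᵀ)`. -/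
def qcov : Matrix (Fin n) (Fin n) ℂ := fun j k => ρ.expectMul (ρ.xi x j) (ρ.xi x k)

/-- `σ_{jk} = Re 𝐄 (ξ_j ξ_k)`. -/
def sig : Matrix (Fin n) (Fin n) ℝ := fun j k => (ρ.expectMul (ρ.xi x j) (ρ.xi x k)).re

/-- `ε_j = Re 𝐄 (η ξ_j)`. -/
def eps : Fin n → ℝ := fun j => (ρ.expectMul (ρ.eta H) (ρ.xi x j)).re

/-- `γ_{jk} = Re 𝐄 (η ξ_j ξ_k)`. -/
def gam : Matrix (Fin n) (Fin n) ℝ := fun j k =>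
  (ρ.expectMul (ρ.eta H) (mulOp (ρ.xi x j) (ρ.xi x k))).re

/-- `τ_{jkl} = Re 𝐄 (ξ_j ξ_k ξ_l)`. -/
def tau : Fin n → Fin n → Fin n → ℝ := fun j k l =>
  (ρ.expectMul (ρ.xi x j) (mulOp (ρ.xi x k) (ρ.xi x l))).re

/-- The mean square deviation `Q(α, β, R) = 𝐄 ((η - h)²)`, where
`h = α + βᵀ ξ + ξᵀ R ξ / 2`. -/
def deviation (α : ℝ) (β : Fin n → ℝ) (R : Matrix (Fin n) (Fin n) ℝ) : ℝ :=
  ρ.meanSq (ρ.eta H - quadOp (ρ.xi x) α β R)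

/-- The state is Gaussian: `𝐄 exp (i uᵀ ξ) = exp (- uᵀ Σ u / 2)` for all real vectors `u`. Here
`exp (i uᵀ ξ) = exp (- i uᵀ 𝐄 x) exp (i uᵀ x)`, and `exp (i uᵀ x) = W u`. -/
def IsGaussian (W : (Fin n → ℝ) → 𝓗 →L[ℂ] 𝓗) : Prop :=
  ∀ u : Fin n → ℝ,
    ρ.expect ((Complex.exp (-(Complex.I * ((u ⬝ᵥ ρ.meanVec x : ℝ) : ℂ))) • W u : 𝓗 →L[ℂ] 𝓗)
        |>.toLinearMap.toPMap ⊤)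
      = Complex.exp (-(((u ⬝ᵥ (ρ.sig x).mulVec u : ℝ) : ℂ) / 2))

end moments

/-- In a pairing with `ρ`, the eigenvalues act on the coordinates. -/
theorem inner_basis_op (i : ι) (v : 𝓗) :
    ⟪ρ.basis i, ρ.op v⟫_ℂ = (ρ.prob i : ℂ) * ⟪ρ.basis i, v⟫_ℂ := by
  classical
  have h := ((ρ.basis.hasSum_repr v).mapL ρ.op).mapL (innerSL ℂ (ρ.basis i))
  have h' := hasSum_ite_eq i ((ρ.prob i : ℂ) * ⟪ρ.basis i, v⟫_ℂ)
  refine h.unique (h'.congr_fun ?_)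
  intro j
  have ho := (orthonormal_iff_ite.mp ρ.basis.orthonormal) i j
  simp only [map_smul, ρ.op_basis, innerSL_apply_apply, smul_eq_mul, ρ.basis.repr_apply_apply, ho]
  by_cases hij : i = j
  · subst hij; simp; ring
  · simp [hij, Ne.symm hij]

/-- `expect` is the trace of `ρ A`. -/
theorem expect_eq_trace (A : 𝓗 →ₗ.[ℂ] 𝓗) :
    ρ.expect A = ∑' i, ⟪ρ.basis i, ρ.op (app A (ρ.basis i))⟫_ℂ := by
  simp only [expect, inner_basis_op]

/-- A density operator has trace one. -/
theorem hasSum_trace : HasSum (fun i => ⟪ρ.basis i, ρ.op (ρ.basis i)⟫_ℂ) 1 := by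
  have h : (fun i => ⟪ρ.basis i, ρ.op (ρ.basis i)⟫_ℂ) = fun i => ((ρ.prob i : ℝ) : ℂ) := by
    funext i
    rw [inner_basis_op, inner_self_eq_norm_sq_to_K, ρ.basis.orthonormal.1 i]
    simp
  rw [h]
  simpa using (Complex.hasSum_ofReal (f := ρ.prob) (x := 1)).mpr ρ.hasSum_prob

end DensityOperator

/-! ### Symmetric matrices and the operator `K` -/

/-- The space of real symmetric matrices of order `n`. -/
def symMats (n : ℕ) : Submodule ℝ (Matrix (Fin n) (Fin n) ℝ) where
  carrier := {R | R.IsSymm}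
  zero_mem' := Matrix.isSymm_zero
  add_mem' := fun ha hb => ha.add hb
  smul_mem' := fun c _ ha => ha.smul c

/-- `K(R) = Σ R Σ + Θ R Θ / 4`. -/
def kOp {n : ℕ} (Sg Θ R : Matrix (Fin n) (Fin n) ℝ) : Matrix (Fin n) (Fin n) ℝ :=
  Sg * R * Sg + (1 / 4 : ℝ) • (Θ * R * Θ)

/-- The inverse `K⁻¹` of `K` on the space of symmetric matrices. -/
def kInv {n : ℕ} (Sg Θ : Matrix (Fin n) (Fin n) ℝ) :
    Matrix (Fin n) (Fin n) ℝ → Matrix (Fin n) (Fin n) ℝ :=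
  Function.invFunOn (kOp Sg Θ) (symMats n : Set (Matrix (Fin n) (Fin n) ℝ))

end QuantumQuad

end

/-!
# Optimal quadratic approximation of an observable in a Gaussian quantum state

The density operator `ρ = ∑ p_i |e_i⟩⟨e_i|` is represented by the unit vector `Ω = (√p_i e_i)` of a
direct sum `EigenSum ι 𝓗` of copies of `𝓗`, on which operators act in each summand (`Lifts`). An
operator `A` with finite second moment becomes the vector `A Ω`; the expectations of products of two
operators become inner products, and `Q` becomes the squared distance of `η Ω` from
`(α + βᵀ ξ + ξᵀ R ξ / 2) Ω`.

For the Weyl operators `V u = exp (i uᵀ ξ)`, the commutation relations and the Gaussian property give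
the whole Gram kernel `⟪V u Ω, V v Ω⟫ = exp (- uᵀ Σ u / 2 - vᵀ Σ v / 2 + uᵀ S v)` with
`S = Σ + i Θ / 2` (`IsGaussianVector.inner_vacuum`). A curve in a Hilbert space whose Gram kernel is a
`C²` function of the difference of the parameters is differentiable
(`exists_hasDerivAt_of_inner_eq`). Hence `t ↦ V (t e_j) Ω` is differentiable at `0`, with derivative
`D_j = i ξ_j Ω`, and so is `t ↦ V (t e_j) D_k`, with derivative `- ξ_j ξ_k Ω`. Differentiability in
the direct sum implies it in each summand, and a self-adjoint operator contained in the generator of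
a unitary group is all of it (`acts_of_hasDerivAt`); so the eigenvectors with `p_i ≠ 0` lie in the
domains of `ξ_j` and of `ξ_j ξ_k`, with finite second moments. Differentiating the kernel gives all
the moments up to the fourth order, that is, Wick's formula (`exists_isWickFamily`).

With these moments the deviation is the explicit quadratic function
`Q = ‖η Ω‖² - 2 βᵀ ε - ⟨R, Γ⟩ + (α + ⟨Σ, R⟩ / 2)² + βᵀ Σ β + ⟨R, K R⟩ / 2`
(`IsWickFamily.norm_sub_quadVec_sq`). As a Gram matrix, `S` is positive semidefinite, and being
nonsingular it is positive definite; hence so are its real part `Σ` and the operator `K`, because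
`⟨R, K R⟩ = Tr (R S R Sᵀ)` is the squared Hilbert-Schmidt norm of `B R Bᵀ` if `S = Bᴴ B`
(`trace_kOp_pos`). Completing the square yields the minimizer (`isMinimizer_iff`).
-/

namespace QuantumQuad

open Filter Topology Matrix
open scoped ComplexOrder

/-! ### Differentiability from the Gram kernel -/

/-- The mixed second difference quotients of a `C²` function of `t - s` converge jointly. -/
theorem tendsto_mixed_difference_quotient {g : ℝ → ℂ} (hg : ContDiff ℝ 2 g) :
    Tendsto (fun p : ℝ × ℝ => ((p.1 * p.2)⁻¹ : ℝ) • (g (p.2 - p.1) - g p.2 - g (-p.1) + g 0))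
      (𝓝[≠] 0 ×ˢ 𝓝[≠] 0) (𝓝 (-(deriv (deriv g) 0))) := by
  set d := deriv (deriv g) 0
  have hg1 : ContDiff ℝ 1 (deriv g) := ((contDiff_succ_iff_deriv (n := 1)).1 hg).2.2
  have hs : HasStrictDerivAt (deriv g) d 0 :=
    hg1.contDiffAt.hasStrictDerivAt (by norm_num)
  have hdiff : Differentiable ℝ g := hg.differentiable (by norm_num)
  rw [Metric.tendsto_nhds]
  intro ε hε
  have h1 := hs.isLittleO.def (half_pos hε)
  obtain ⟨δ, hδ, hb⟩ := Metric.eventually_nhds_iff.1 h1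
  have hev : ∀ᶠ a : ℝ in 𝓝[≠] 0, |a| < δ / 2 ∧ a ≠ 0 := by
    refine (Filter.Eventually.and ?_ self_mem_nhdsWithin)
    refine nhdsWithin_le_nhds ?_
    filter_upwards [Metric.ball_mem_nhds (0 : ℝ) (half_pos hδ)] with a ha
    simpa using ha
  filter_upwards [hev.prod_mk hev] with p hp
  obtain ⟨⟨ha, ha0⟩, hb', hb0⟩ := hp
  obtain ⟨a, b⟩ := p
  simp only at ha ha0 hb' hb0 ⊢
  -- the mean value inequality for `y ↦ g (y - a) - g y + y • a • d` on `[-δ/2, δ/2]`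
  have hmv : ‖(g (b - a) - g b + b • a • d) - (g (0 - a) - g 0 + (0 : ℝ) • a • d)‖
      ≤ ε / 2 * |a| * ‖b - 0‖ := by
    refine Convex.norm_image_sub_le_of_norm_hasDerivWithin_le
      (f := fun y : ℝ => g (y - a) - g y + y • a • d)
      (f' := fun y => deriv g (y - a) - deriv g y + a • d) (s := Metric.ball (0 : ℝ) (δ / 2))
      ?_ ?_ (convex_ball _ _) (by simpa using half_pos hδ) (by simpa using hb')
    · intro y _
      have e1 : HasDerivAt (fun y => g (y - a)) (deriv g (y - a)) y := by
        simpa using (hdiff (y - a)).hasDerivAt.comp_sub_const y a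
      have e2 : HasDerivAt (fun y : ℝ => y • a • d) (a • d) y := by
        simpa using (hasDerivAt_id y).smul_const (a • d)
      exact ((e1.sub (hdiff y).hasDerivAt).add e2).hasDerivWithinAt
    · intro y hy
      have hy' : |y| < δ / 2 := by simpa using hy
      have := @hb (y - a, y) (by
        rw [Prod.dist_eq, sup_lt_iff]
        simp only [Real.dist_eq, sub_zero]
        constructor
        · calc |y - a| ≤ |y| + |a| := abs_sub _ _
            _ < δ := by linarith
        · linarith)
      simp only [ContinuousLinearMap.toSpanSingleton_apply, sub_sub_cancel_left, norm_neg,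
        Real.norm_eq_abs, neg_smul, sub_neg_eq_add] at this
      exact this
  rw [dist_eq_norm]
  have hab : (a * b) ≠ 0 := mul_ne_zero ha0 hb0
  have key : ((a * b)⁻¹ : ℝ) • (g (b - a) - g b - g (-a) + g 0) - -d
      = ((a * b)⁻¹ : ℝ) •
        ((g (b - a) - g b + b • a • d) - (g (0 - a) - g 0 + (0 : ℝ) • a • d)) := by
    have : d = ((a * b)⁻¹ : ℝ) • (b • a • d) := by
      rw [smul_smul, smul_smul]
      rw [show (a * b)⁻¹ * b * a = 1 by field_simp]
      simp
    nth_rw 1 [this]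
    rw [sub_neg_eq_add, ← smul_add]
    congr 1
    rw [zero_smul, zero_sub]
    abel
  rw [key, norm_smul, norm_inv, Real.norm_eq_abs]
  calc |a * b|⁻¹ * _ ≤ |a * b|⁻¹ * (ε / 2 * |a| * ‖b - 0‖) := by gcongr
    _ = ε / 2 := by
      rw [sub_zero, Real.norm_eq_abs, abs_mul]
      have := abs_ne_zero.2 ha0
      have := abs_ne_zero.2 hb0
      field_simp
    _ < ε := half_lt_self hε

variable {E : Type*} [NormedAddCommGroup E] [InnerProductSpace ℂ E]

/-- A family of vectors converges as soon as its Gram matrix does. -/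
theorem exists_tendsto_of_tendsto_inner [CompleteSpace E] {α : Type*} {l : Filter α} [l.NeBot]
    {q : α → E} {c : ℂ} (h : Tendsto (fun p : α × α => ⟪q p.1, q p.2⟫_ℂ) (l ×ˢ l) (𝓝 c)) :
    ∃ v, Tendsto q l (𝓝 v) := by
  have hC : Cauchy (map q l) := by
    rw [cauchy_map_iff]
    refine ⟨inferInstance, ?_⟩
    rw [tendsto_uniformity_iff_dist_tendsto_zero]
    have hre := (Complex.continuous_re.tendsto c).comp h
    have hdiag : Tendsto (fun a : α => (a, a)) l (l ×ˢ l) := tendsto_id.prodMk tendsto_id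
    have h1 := (hre.comp hdiag).comp (tendsto_fst (f := l) (g := l))
    have h2 := (hre.comp hdiag).comp (tendsto_snd (f := l) (g := l))
    have h3 := ((h1.sub (hre.const_mul 2)).add h2).sqrt
    rw [show c.re - 2 * c.re + c.re = 0 by ring, Real.sqrt_zero] at h3
    refine h3.congr fun p => ?_
    rw [dist_eq_norm, ← Real.sqrt_sq (norm_nonneg (q p.1 - q p.2))]
    congr 1
    rw [@norm_sub_sq ℂ, ← inner_self_eq_norm_sq (𝕜 := ℂ) (q p.1),
      ← inner_self_eq_norm_sq (𝕜 := ℂ) (q p.2)]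
    rfl
  exact cauchy_iff_exists_le_nhds.1 hC

/-- A curve whose Gram kernel is a `C²` function of the difference of the parameters is
differentiable. -/
theorem exists_hasDerivAt_of_inner_eq [CompleteSpace E] {f : ℝ → E} {g : ℝ → ℂ}
    (hg : ContDiff ℝ 2 g) (h : ∀ s t, ⟪f s, f t⟫_ℂ = g (t - s)) : ∃ f', HasDerivAt f f' 0 := by
  have hl : Tendsto (fun p : ℝ × ℝ => ⟪p.1⁻¹ • (f p.1 - f 0), p.2⁻¹ • (f p.2 - f 0)⟫_ℂ)
      (𝓝[≠] 0 ×ˢ 𝓝[≠] 0) (𝓝 (-(deriv (deriv g) 0))) := by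
    refine (tendsto_mixed_difference_quotient hg).congr fun p => ?_
    simp only [← Complex.coe_smul, inner_smul_left, inner_smul_right, inner_sub_left,
      inner_sub_right, h, Complex.conj_ofReal, smul_eq_mul, zero_sub, sub_zero]
    push_cast
    rw [mul_inv]
    ring
  obtain ⟨v, hv⟩ := exists_tendsto_of_tendsto_inner
    (q := fun t : ℝ => t⁻¹ • (f t - f 0)) hl
  refine ⟨v, hasDerivAt_iff_tendsto_slope_zero.2 ?_⟩
  simpa using hv

/-! ### Gaussian vectors of a Weyl system -/

/-- The derivative at `0` of a polynomial times the exponential of a quadratic polynomial. -/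
theorem eq_of_hasDerivAt_poly_mul_exp {f : ℝ → ℂ} {f' : ℂ} (h : HasDerivAt f f' 0)
    (p₀ p₁ p₂ p₃ c₀ c₁ c₂ : ℂ)
    (hf : ∀ t : ℝ, f t = (p₀ + p₁ * t + p₂ * t ^ 2 + p₃ * t ^ 3)
      * Complex.exp (c₀ + c₁ * t + c₂ * t ^ 2)) :
    f' = (p₁ + p₀ * c₁) * Complex.exp c₀ := by
  have hi : HasDerivAt (fun t : ℝ => (t : ℂ)) 1 0 := Complex.ofRealCLM.hasDerivAt
  have h2 := (((((hi.const_mul p₁).const_add p₀).add ((hi.pow 2).const_mul p₂)).add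
    ((hi.pow 3).const_mul p₃)).mul
      (((hi.const_mul c₁).const_add c₀).add ((hi.pow 2).const_mul c₂)).cexp)
  rw [show f = _ from funext hf] at h
  rw [h.unique h2]
  simp
  ring

theorem hasDerivAt_inner_right {γ : ℝ → E} {D : E} (hD : HasDerivAt γ D 0) (z : E)
    (T : E →L[ℂ] E) : HasDerivAt (fun t : ℝ => ⟪z, T (γ t)⟫_ℂ) ⟪z, T D⟫_ℂ 0 := by
  have h1 : HasDerivAt (fun t : ℝ => T (γ t)) (T D) 0 :=
    (T.restrictScalars ℝ).hasFDerivAt.comp_hasDerivAt 0 hD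
  simpa using (hasDerivAt_const (0 : ℝ) z).inner ℂ h1

theorem hasDerivAt_inner_left {γ : ℝ → E} {D : E} (hD : HasDerivAt γ D 0) (z : E)
    (T : E →L[ℂ] E) : HasDerivAt (fun t : ℝ => ⟪T (γ t), z⟫_ℂ) ⟪T D, z⟫_ℂ 0 := by
  have h1 : HasDerivAt (fun t : ℝ => T (γ t)) (T D) 0 :=
    (T.restrictScalars ℝ).hasFDerivAt.comp_hasDerivAt 0 hD
  simpa using h1.inner ℂ (hasDerivAt_const (0 : ℝ) z)

variable {U : Type*} [AddCommGroup U] [Module ℝ U]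

/-- The complex bilinear form `σ + i θ / 2`. -/
noncomputable def qform (σ θ : LinearMap.BilinForm ℝ U) (u v : U) : ℂ :=
  (σ u v : ℂ) + Complex.I * (θ u v : ℂ) / 2

/-- A Weyl system `V` of isometries over the real vector space `U`, with commutator form `θ`, and
a vector `Ω` with centered Gaussian characteristic function `⟪Ω, V u Ω⟫ = exp (- σ (u, u) / 2)`. -/
structure IsGaussianVector (σ θ : LinearMap.BilinForm ℝ U) (V : U → E →L[ℂ] E) (Ω : E) :
    Prop where
  symm : ∀ u v, σ u v = σ v u
  antisymm : ∀ u v, θ u v = -θ v u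
  map_zero : ∀ v, V 0 v = v
  inner_map : ∀ u v w, ⟪V u v, V u w⟫_ℂ = ⟪v, w⟫_ℂ
  weyl : ∀ u u' v, V u (V u' v) = Complex.exp (-(Complex.I * (θ u u' : ℂ) / 2)) • V (u + u') v
  gauss : ∀ u, ⟪Ω, V u Ω⟫_ℂ = Complex.exp (-((σ u u : ℂ) / 2))

namespace IsGaussianVector

variable {σ θ : LinearMap.BilinForm ℝ U} {V : U → E →L[ℂ] E} {Ω : E}

theorem alt (h : IsGaussianVector σ θ V Ω) (u : U) : θ u u = 0 := by
  have := h.antisymm u u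
  linarith

/-- The Gram kernel of the displaced vectors `V u Ω`. -/
theorem inner_vacuum (h : IsGaussianVector σ θ V Ω) (u v : U) :
    ⟪V u Ω, V v Ω⟫_ℂ
      = Complex.exp (-((σ u u : ℂ) / 2) - (σ v v : ℂ) / 2 + qform σ θ u v) := by
  rw [← h.inner_map (-u), h.weyl, h.weyl, inner_smul_left, inner_smul_right, neg_add_cancel,
    h.map_zero, h.gauss, ← Complex.exp_conj, ← Complex.exp_add, ← Complex.exp_add]
  congr 1
  simp only [map_neg, map_add, LinearMap.neg_apply, LinearMap.add_apply, h.alt, qform,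
    h.symm v u]
  push_cast
  simp
  ring

/-- `Ω` lies in the domain of every field operator. -/
theorem exists_hasDerivAt_vacuum [CompleteSpace E] (h : IsGaussianVector σ θ V Ω) (m : U) :
    ∃ D, HasDerivAt (fun t : ℝ => V (t • m) Ω) D 0 := by
  refine exists_hasDerivAt_of_inner_eq
    (g := fun r : ℝ => Complex.exp ((-(σ m m) / 2 * r ^ 2 : ℝ) : ℂ)) ?_ fun s t => ?_
  · exact (Complex.ofRealCLM.contDiff.comp (contDiff_const.mul (contDiff_id.pow 2))).cexp
  · rw [h.inner_vacuum]
    congr 1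
    simp only [map_smul, LinearMap.smul_apply, h.alt, qform, smul_eq_mul]
    push_cast
    ring

/-- The first moments between displaced vectors: `D` is the derivative of `V (t • m) Ω` at `0`, the
vector `i ξ_m Ω`. -/
theorem inner_vacuum_deriv (h : IsGaussianVector σ θ V Ω) {m : U} {D : E}
    (hD : HasDerivAt (fun t : ℝ => V (t • m) Ω) D 0) (u v : U) :
    ⟪V u Ω, V v D⟫_ℂ = (qform σ θ u m - qform σ θ v m)
      * Complex.exp (-((σ u u : ℂ) / 2) - (σ v v : ℂ) / 2 + qform σ θ u v) := by
  rw [eq_of_hasDerivAt_poly_mul_exp (hasDerivAt_inner_right hD _ (V v)) 1 0 0 0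
    (-((σ u u : ℂ) / 2) - (σ v v : ℂ) / 2 + qform σ θ u v)
    (qform σ θ u m - qform σ θ v m) (-((σ m m : ℂ) / 2)) fun t => ?_]
  · ring
  · rw [h.weyl, inner_smul_right, h.inner_vacuum, ← Complex.exp_add]
    simp only [zero_mul, add_zero, one_mul]
    congr 1
    simp only [map_add, map_smul, LinearMap.add_apply, LinearMap.smul_apply, qform, smul_eq_mul,
      h.symm m v]
    push_cast
    ring

/-- The second moments between displaced vectors. -/
theorem inner_deriv_deriv (h : IsGaussianVector σ θ V Ω) {k m : U} {D D' : E}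
    (hD : HasDerivAt (fun t : ℝ => V (t • k) Ω) D 0)
    (hD' : HasDerivAt (fun t : ℝ => V (t • m) Ω) D' 0) (u v : U) :
    ⟪V u D, V v D'⟫_ℂ
      = (qform σ θ k m - qform σ θ (v - u) m * qform σ θ k (v - u))
      * Complex.exp (-((σ u u : ℂ) / 2) - (σ v v : ℂ) / 2 + qform σ θ u v) := by
  rw [eq_of_hasDerivAt_poly_mul_exp (hasDerivAt_inner_left hD (V v D') (V u))
    (qform σ θ u m - qform σ θ v m) (qform σ θ k m) 0 0
    (-((σ u u : ℂ) / 2) - (σ v v : ℂ) / 2 + qform σ θ u v)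
    (qform σ θ k (v - u)) (-((σ k k : ℂ) / 2)) fun t => ?_]
  · congr 1
    simp only [qform, map_sub, LinearMap.sub_apply]
    push_cast
    ring
  · rw [h.weyl, inner_smul_left, h.inner_vacuum_deriv hD', ← Complex.exp_conj, mul_left_comm,
      ← Complex.exp_add]
    congr 1
    · simp only [map_add, map_smul, LinearMap.add_apply, LinearMap.smul_apply, qform, smul_eq_mul]
      push_cast
      ring
    · congr 1
      simp only [map_add, map_smul, map_sub, LinearMap.add_apply, LinearMap.smul_apply, qform,
        smul_eq_mul, h.symm k u, h.antisymm k u]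
      simp only [map_neg, map_mul, map_div₀, Complex.conj_I, Complex.conj_ofReal, map_ofNat]
      push_cast
      ring

/-- The vector `i ξ_k Ω` lies in the domain of every field operator: its Gram kernel under
`t ↦ V (t • j)` is a polynomial times a Gaussian function of the difference of the parameters. -/
theorem exists_hasDerivAt_deriv [CompleteSpace E] (h : IsGaussianVector σ θ V Ω) {k : U} {D : E}
    (hD : HasDerivAt (fun t : ℝ => V (t • k) Ω) D 0) (j : U) :
    ∃ D', HasDerivAt (fun t : ℝ => V (t • j) D) D' 0 := by
  refine exists_hasDerivAt_of_inner_eq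
    (g := fun r : ℝ => (qform σ θ k k - (r : ℂ) ^ 2 * (qform σ θ j k * qform σ θ k j)) *
      Complex.exp ((-(σ j j) / 2 * r ^ 2 : ℝ) : ℂ)) ?_ fun s t => ?_
  · have hr : ContDiff ℝ 2 (fun r : ℝ => (r : ℂ)) := Complex.ofRealCLM.contDiff
    exact (contDiff_const.sub ((hr.pow 2).mul contDiff_const)).mul
      (Complex.ofRealCLM.contDiff.comp (contDiff_const.mul (contDiff_id.pow 2))).cexp
  · rw [h.inner_deriv_deriv hD hD]
    congr 1
    · simp only [map_smul, map_sub, LinearMap.smul_apply, LinearMap.sub_apply, qform, smul_eq_mul]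
      push_cast
      ring
    · congr 1
      simp only [map_smul, LinearMap.smul_apply, h.alt, qform, smul_eq_mul]
      push_cast
      ring

/-- The second moments again, now paired with `Ω`: the vector `D'` is `- ξ_l ξ_m Ω`. -/
theorem inner_vacuum_deriv₂ (h : IsGaussianVector σ θ V Ω) {l m : U} {D D' : E}
    (hD : HasDerivAt (fun t : ℝ => V (t • m) Ω) D 0)
    (hD' : HasDerivAt (fun t : ℝ => V (t • l) D) D' 0) :
    ⟪Ω, D'⟫_ℂ = -qform σ θ l m := by
  have h1 := hasDerivAt_inner_right hD' Ω (V 0)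
  rw [h.map_zero] at h1
  rw [eq_of_hasDerivAt_poly_mul_exp h1 0 (-qform σ θ l m) 0 0 0 0 (-((σ l l : ℂ) / 2))
    fun t => ?_]
  · simp
  · have := h.inner_vacuum_deriv hD 0 (t • l)
    rw [h.map_zero] at this
    rw [h.map_zero, this]
    simp [qform]
    ring_nf

/-- The third moments of a Gaussian vector vanish. -/
theorem inner_deriv_deriv₂ (h : IsGaussianVector σ θ V Ω) {k l m : U} {D D' D'' : E}
    (hD : HasDerivAt (fun t : ℝ => V (t • k) Ω) D 0)
    (hD' : HasDerivAt (fun t : ℝ => V (t • m) Ω) D' 0)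
    (hD'' : HasDerivAt (fun t : ℝ => V (t • l) D') D'' 0) :
    ⟪D, D''⟫_ℂ = 0 := by
  have h1 := hasDerivAt_inner_right hD'' D (V 0)
  rw [h.map_zero] at h1
  rw [eq_of_hasDerivAt_poly_mul_exp h1 (qform σ θ k m) 0 (-(qform σ θ l m * qform σ θ k l)) 0
    0 0 (-((σ l l : ℂ) / 2)) fun t => ?_]
  · simp
  · have := h.inner_deriv_deriv hD hD' 0 (t • l)
    rw [h.map_zero] at this
    rw [h.map_zero, this]
    congr 1
    · simp [qform]
      ring
    · congr 1
      simp [qform]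
      ring

/-- Wick's formula for the fourth moments of a Gaussian vector. -/
theorem inner_deriv₂_deriv₂ (h : IsGaussianVector σ θ V Ω) {j k l m : U} {D₁ D₁' D₂ D₂' : E}
    (hD₁ : HasDerivAt (fun t : ℝ => V (t • k) Ω) D₁ 0)
    (hD₁' : HasDerivAt (fun t : ℝ => V (t • j) D₁) D₁' 0)
    (hD₂ : HasDerivAt (fun t : ℝ => V (t • m) Ω) D₂ 0)
    (hD₂' : HasDerivAt (fun t : ℝ => V (t • l) D₂) D₂' 0) :
    ⟪D₁', D₂'⟫_ℂ = qform σ θ k j * qform σ θ l m + qform σ θ k l * qform σ θ j m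
      + qform σ θ k m * qform σ θ j l := by
  have hstep : ∀ s : ℝ, ⟪V (s • j) D₁, D₂'⟫_ℂ
      = (s * (qform σ θ k j * qform σ θ l m + qform σ θ k l * qform σ θ j m)
        + (qform σ θ k m - s ^ 2 * (qform σ θ j m * qform σ θ k j)) * (s * qform σ θ j l))
        * Complex.exp (-((σ j j : ℂ) / 2) * s ^ 2) := by
    intro s
    have h1 := hasDerivAt_inner_right hD₂' (V (s • j) D₁) (V 0)
    rw [h.map_zero] at h1
    refine eq_of_hasDerivAt_poly_mul_exp h1
      (qform σ θ k m - s ^ 2 * (qform σ θ j m * qform σ θ k j))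
      (s * (qform σ θ k j * qform σ θ l m + qform σ θ k l * qform σ θ j m))
      (-(qform σ θ l m * qform σ θ k l)) 0 (-((σ j j : ℂ) / 2) * s ^ 2) (s * qform σ θ j l)
      (-((σ l l : ℂ) / 2)) fun t => ?_
    rw [h.map_zero, h.inner_deriv_deriv hD₁ hD₂]
    congr 1
    · simp only [map_smul, map_sub, LinearMap.smul_apply, LinearMap.sub_apply, qform, smul_eq_mul]
      push_cast
      ring
    · congr 1
      simp only [map_smul, LinearMap.smul_apply, qform, smul_eq_mul]
      push_cast
      ring
  have h2 := hasDerivAt_inner_left hD₁' D₂' (V 0)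
  rw [h.map_zero] at h2
  rw [eq_of_hasDerivAt_poly_mul_exp h2 0
    (qform σ θ k j * qform σ θ l m + qform σ θ k l * qform σ θ j m
      + qform σ θ k m * qform σ θ j l) 0
    (-(qform σ θ j m * qform σ θ k j) * qform σ θ j l) 0 0 (-((σ j j : ℂ) / 2)) fun s => ?_]
  · simp
  · rw [h.map_zero, hstep]
    congr 1
    · ring
    · congr 1
      ring

end IsGaussianVector

/-! ### Quantum covariance matrices and the operator `K` -/

section Matrices

variable {n : ℕ} {Sg Θ : Matrix (Fin n) (Fin n) ℝ}

/-- The quantum covariance matrix `S = Σ + i Θ / 2`. -/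
noncomputable def qcovMat (Sg Θ : Matrix (Fin n) (Fin n) ℝ) : Matrix (Fin n) (Fin n) ℂ :=
  Sg.map Complex.ofReal + (Complex.I / 2) • Θ.map Complex.ofReal

theorem qcovMat_apply (j k : Fin n) :
    qcovMat Sg Θ j k = (Sg j k : ℂ) + Complex.I * (Θ j k : ℂ) / 2 := by
  simp [qcovMat]
  ring

theorem qcovMat_transpose (hSg : Sg.IsSymm) (hΘ : Θᵀ = -Θ) :
    (qcovMat Sg Θ)ᵀ = Sg.map Complex.ofReal - (Complex.I / 2) • Θ.map Complex.ofReal := by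
  ext j k
  have h1 := congrFun₂ hSg j k
  have h2 := congrFun₂ hΘ j k
  simp only [transpose_apply, Matrix.neg_apply] at h1 h2
  simp [qcovMat, h1, h2]
  ring

theorem dotProduct_mulVec_self_of_antisymm (hΘ : Θᵀ = -Θ) (v : Fin n → ℝ) :
    v ⬝ᵥ Θ *ᵥ v = 0 := by
  have h : v ⬝ᵥ Θ *ᵥ v = v ⬝ᵥ Θᵀ *ᵥ v := by
    rw [mulVec_transpose, dotProduct_comm v (v ᵥ* Θ), ← dotProduct_mulVec]
  rw [hΘ, neg_mulVec, dotProduct_neg] at h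
  linarith

/-- On real vectors the quadratic form of `S` is that of its real part `Σ`. -/
theorem posDef_of_qcovMat_posDef (hSg : Sg.IsSymm) (hΘ : Θᵀ = -Θ) (hS : (qcovMat Sg Θ).PosDef) :
    Sg.PosDef := by
  refine PosDef.of_dotProduct_mulVec_pos (by simp [IsHermitian, hSg.eq]) fun v hv => ?_
  have hv' : (fun j => (v j : ℂ)) ≠ 0 := by
    contrapose! hv
    ext j
    simpa using congrFun hv j
  have h := hS.dotProduct_mulVec_pos hv'
  have h0 := dotProduct_mulVec_self_of_antisymm hΘ v
  have hre : (star (fun j => (v j : ℂ)) ⬝ᵥ qcovMat Sg Θ *ᵥ fun j => (v j : ℂ))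
      = ((v ⬝ᵥ Sg *ᵥ v : ℝ) : ℂ) + Complex.I / 2 * ((v ⬝ᵥ Θ *ᵥ v : ℝ) : ℂ) := by
    simp only [dotProduct, mulVec, qcovMat_apply, Pi.star_apply, RCLike.star_def,
      Complex.conj_ofReal, Complex.ofReal_sum, Complex.ofReal_mul, Finset.mul_sum,
      ← Finset.sum_add_distrib]
    refine Finset.sum_congr rfl fun j _ => Finset.sum_congr rfl fun k _ => ?_
    ring
  rw [hre, h0] at h
  simpa using h

/-- The quadratic form of `K` is `Tr (R S R Sᵀ)`. -/
theorem trace_mul_qcovMat (hSg : Sg.IsSymm) (hΘ : Θᵀ = -Θ) (R : Matrix (Fin n) (Fin n) ℝ) :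
    (R.map Complex.ofReal * qcovMat Sg Θ * R.map Complex.ofReal * (qcovMat Sg Θ)ᵀ).trace
      = ((R * kOp Sg Θ R).trace : ℝ) := by
  have hm : ∀ A B : Matrix (Fin n) (Fin n) ℝ, A.map Complex.ofReal * B.map Complex.ofReal
      = (A * B).map Complex.ofReal := fun A B => (Matrix.map_mul (f := Complex.ofRealHom)).symm
  have ht : ∀ A : Matrix (Fin n) (Fin n) ℝ, (A.map Complex.ofReal).trace = (A.trace : ℂ) :=
    fun A => (AddMonoidHom.map_trace (Complex.ofRealHom : ℝ →+ ℂ) A).symm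
  have hc : (R * Θ * R * Sg).trace = (R * Sg * R * Θ).trace := by
    rw [Matrix.mul_assoc (R * Θ), trace_mul_comm, ← Matrix.mul_assoc]
  rw [qcovMat_transpose hSg hΘ, qcovMat]
  simp only [Matrix.mul_add, Matrix.mul_sub, Matrix.add_mul, Matrix.mul_smul,
    Matrix.smul_mul, hm, trace_add, trace_sub, trace_smul, ht, hc, kOp, ← Matrix.mul_assoc,
    smul_eq_mul]
  push_cast
  linear_combination (- ((R * Θ * R * Θ).trace : ℂ) / 4) * Complex.I_mul_I

/-- Positivity of `K` is inherited from the quantum covariance matrix `S`, not from `Σ` alone. -/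
theorem trace_kOp_pos (hSg : Sg.IsSymm) (hΘ : Θᵀ = -Θ) (hS : (qcovMat Sg Θ).PosDef)
    {R : Matrix (Fin n) (Fin n) ℝ} (hR : R.IsSymm) (hR0 : R ≠ 0) :
    0 < (R * kOp Sg Θ R).trace := by
  obtain ⟨B, hB⟩ : ∃ B, qcovMat Sg Θ = Bᴴ * B := by
    open scoped MatrixOrder in
    exact CStarAlgebra.nonneg_iff_eq_star_mul_self.mp hS.posSemidef.nonneg
  have hBu : IsUnit B := by
    have := hS.isUnit
    rw [hB, isUnit_iff_isUnit_det, det_mul] at this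
    exact (isUnit_iff_isUnit_det _).2 (isUnit_of_mul_isUnit_right this)
  set R' := R.map Complex.ofReal with hR'
  have hRh : R'ᴴ = R' := by
    rw [hR']
    ext j k
    simpa using congrFun₂ hR j k
  -- with `S = Bᴴ B`, the trace `Tr (R S R Sᵀ)` is the squared Hilbert-Schmidt norm of `B R Bᵀ`
  have hM : (R' * qcovMat Sg Θ * R' * (qcovMat Sg Θ)ᵀ).trace
      = ((B * R' * Bᵀ)ᴴ * (B * R' * Bᵀ)).trace := by
    rw [hB, transpose_mul, conjTranspose_mul, conjTranspose_mul, hRh]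
    have : Bᵀᴴ = Bᴴᵀ := by ext; simp
    rw [this, ← Matrix.mul_assoc (R' * (Bᴴ * B) * R') Bᵀ, trace_mul_comm]
    simp only [Matrix.mul_assoc]
  have hne : (B * R' * Bᵀ) ≠ 0 := by
    intro h0
    have hBt : IsUnit Bᵀ := by
      rw [isUnit_iff_isUnit_det, det_transpose]
      exact (isUnit_iff_isUnit_det _).1 hBu
    have h1 : B * R' = 0 := by simpa [hBt.mul_left_eq_zero] using h0
    have h2 : R' = 0 := by simpa [hBu.mul_right_eq_zero] using h1
    apply hR0
    ext j k
    have := congrFun₂ h2 j k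
    simpa [hR'] using this
  have hnn : 0 ≤ ((B * R' * Bᵀ)ᴴ * (B * R' * Bᵀ)).trace :=
    (posSemidef_conjTranspose_mul_self _).trace_nonneg
  have hpos := lt_of_le_of_ne hnn (Ne.symm (mt trace_conjTranspose_mul_self_eq_zero_iff.1 hne))
  rw [← hM, hR', trace_mul_qcovMat hSg hΘ] at hpos
  exact_mod_cast hpos

theorem trace_mul_kOp_comm (X Y : Matrix (Fin n) (Fin n) ℝ) :
    (X * kOp Sg Θ Y).trace = (kOp Sg Θ X * Y).trace := by
  have h : ∀ A : Matrix (Fin n) (Fin n) ℝ, (X * (A * Y * A)).trace = (A * X * A * Y).trace := by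
    intro A
    rw [← Matrix.mul_assoc, trace_mul_comm]
    simp only [Matrix.mul_assoc]
  simp only [kOp, Matrix.mul_add, Matrix.add_mul, Matrix.mul_smul, Matrix.smul_mul, trace_add,
    trace_smul, h]

theorem kOp_isSymm (hSg : Sg.IsSymm) (hΘ : Θᵀ = -Θ) {R : Matrix (Fin n) (Fin n) ℝ}
    (hR : R.IsSymm) : (kOp Sg Θ R).IsSymm := by
  simp only [IsSymm, kOp, transpose_add, transpose_mul, transpose_smul, hΘ, hSg.eq, hR.eq]
  simp [Matrix.mul_assoc]

variable (Sg Θ) in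
theorem kOp_sub (X Y : Matrix (Fin n) (Fin n) ℝ) :
    kOp Sg Θ (X - Y) = kOp Sg Θ X - kOp Sg Θ Y := by
  simp only [kOp, Matrix.mul_sub, Matrix.sub_mul, smul_sub]
  abel

theorem bijOn_kOp (hSg : Sg.IsSymm) (hΘ : Θᵀ = -Θ) (hS : (qcovMat Sg Θ).PosDef) :
    Set.BijOn (kOp Sg Θ) (symMats n) (symMats n) := by
  let L : symMats n →ₗ[ℝ] symMats n :=
    { toFun := fun R => ⟨kOp Sg Θ R, kOp_isSymm hSg hΘ R.2⟩
      map_add' := fun X Y => Subtype.ext (by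
        simp only [kOp, Submodule.coe_add, Matrix.mul_add, Matrix.add_mul, smul_add]
        abel)
      map_smul' := fun c X => Subtype.ext (by
        simp [kOp, smul_comm c (4⁻¹ : ℝ)]) }
  have hinj : Function.Injective L := by
    refine (injective_iff_map_eq_zero L).2 fun R hR => ?_
    by_contra hR0
    have h := trace_kOp_pos hSg hΘ hS R.2 (fun h0 => hR0 (Subtype.ext h0))
    rw [show kOp Sg Θ (R : Matrix (Fin n) (Fin n) ℝ) = 0 from congrArg Subtype.val hR] at h
    simp at h
  have hsurj : Function.Surjective L := LinearMap.injective_iff_surjective.1 hinj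
  refine ⟨fun R hR => kOp_isSymm hSg hΘ hR, fun X hX Y hY h => ?_, fun Y hY => ?_⟩
  · exact congrArg Subtype.val (@hinj ⟨X, hX⟩ ⟨Y, hY⟩ (Subtype.ext h))
  · obtain ⟨X, hX⟩ := hsurj ⟨Y, hY⟩
    exact ⟨X, X.2, congrArg Subtype.val hX⟩

/-- The minimizers of the quadratic function that the mean square deviation turns out to be. -/
theorem isMinimizer_iff (hSg : Sg.PosDef) (hΘ : Θᵀ = -Θ) (hS : (qcovMat Sg Θ).PosDef)
    {c : ℝ} {ε : Fin n → ℝ} {Γ : Matrix (Fin n) (Fin n) ℝ} (hΓ : Γ ∈ symMats n)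
    {q : ℝ → (Fin n → ℝ) → Matrix (Fin n) (Fin n) ℝ → ℝ}
    (hq : ∀ α β, ∀ R ∈ symMats n, q α β R = c - 2 * (β ⬝ᵥ ε) - (R * Γ).trace
      + (α + (Sg * R).trace / 2) ^ 2 + β ⬝ᵥ Sg *ᵥ β + (R * kOp Sg Θ R).trace / 2)
    (α : ℝ) (β : Fin n → ℝ) {R : Matrix (Fin n) (Fin n) ℝ} (hR : R ∈ symMats n) :
    (∀ α' β', ∀ R' ∈ symMats n, q α β R ≤ q α' β' R') ↔
      α = -(Sg * R).trace / 2 ∧ β = Sg⁻¹ *ᵥ ε ∧ R = kInv Sg Θ Γ := by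
  have hsym : Sg.IsSymm := by simpa [IsHermitian, IsSymm] using hSg.isHermitian
  have hbij := bijOn_kOp hsym hΘ hS
  obtain ⟨R₀, hR₀, hKR₀⟩ := hbij.surjOn hΓ
  have hinv : kInv Sg Θ Γ = R₀ := by
    rw [← hKR₀]
    exact hbij.injOn.leftInvOn_invFunOn hR₀
  set β₀ := Sg⁻¹ *ᵥ ε with hβ₀
  have hSβ₀ : Sg *ᵥ β₀ = ε := by
    rw [hβ₀, mulVec_mulVec, mul_nonsing_inv _ ((isUnit_iff_isUnit_det _).1 hSg.isUnit),
      one_mulVec]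
  -- completion of the square
  have hsq : ∀ α β, ∀ R ∈ symMats n, q α β R = c - β₀ ⬝ᵥ Sg *ᵥ β₀ - (R₀ * kOp Sg Θ R₀).trace / 2
      + (α + (Sg * R).trace / 2) ^ 2 + (β - β₀) ⬝ᵥ Sg *ᵥ (β - β₀)
      + ((R - R₀) * kOp Sg Θ (R - R₀)).trace / 2 := by
    intro α β R hR
    have h1 : β₀ ⬝ᵥ Sg *ᵥ β = β ⬝ᵥ Sg *ᵥ β₀ := by
      rw [dotProduct_mulVec, ← mulVec_transpose, hsym.eq, dotProduct_comm]
    have h2 : (R₀ * kOp Sg Θ R).trace = (R * kOp Sg Θ R₀).trace := by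
      rw [trace_mul_kOp_comm, trace_mul_comm]
    rw [hq α β R hR, ← hSβ₀, ← hKR₀, kOp_sub, mulVec_sub]
    simp only [sub_dotProduct, dotProduct_sub, Matrix.sub_mul, Matrix.mul_sub, trace_sub, h1, h2]
    ring
  have hβnn : ∀ v, 0 ≤ v ⬝ᵥ Sg *ᵥ v := fun v => by
    simpa using hSg.posSemidef.dotProduct_mulVec_nonneg v
  have hRnn : ∀ X ∈ symMats n, 0 ≤ (X * kOp Sg Θ X).trace := fun X hX => by
    by_cases h0 : X = 0
    · simp [h0]
    · exact (trace_kOp_pos hsym hΘ hS hX h0).le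
  rw [hinv]
  constructor
  · intro hmin
    have h := hmin (-(Sg * R₀).trace / 2) β₀ R₀ hR₀
    rw [hsq _ _ _ hR, hsq _ _ _ hR₀] at h
    simp only [sub_self, Matrix.zero_mul, trace_zero, zero_dotProduct] at h
    have e1 := sq_nonneg (α + (Sg * R).trace / 2)
    have e2 := hβnn (β - β₀)
    have e3 := hRnn (R - R₀) ((symMats n).sub_mem hR hR₀)
    ring_nf at h e1 e2 e3
    refine ⟨?_, ?_, ?_⟩
    · have : (α + (Sg * R).trace / 2) ^ 2 = 0 := by
        apply le_antisymm _ (sq_nonneg _)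
        ring_nf
        linarith
      have := pow_eq_zero_iff (two_ne_zero) |>.1 this
      linarith
    · by_contra hne
      have := hSg.dotProduct_mulVec_pos (sub_ne_zero.2 hne)
      simp only [star_trivial] at this
      linarith
    · by_contra hne
      have := trace_kOp_pos hsym hΘ hS ((symMats n).sub_mem hR hR₀) (sub_ne_zero.2 hne)
      linarith
  · rintro ⟨rfl, rfl, rfl⟩ α' β' R' hR'
    rw [hsq _ _ _ hR, hsq _ _ _ hR']
    simp only [sub_self, Matrix.zero_mul, trace_zero, zero_dotProduct]
    have e1 := sq_nonneg (α' + (Sg * R').trace / 2)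
    have e2 := hβnn (β' - β₀)
    have e3 := hRnn (R' - R) ((symMats n).sub_mem hR' hR)
    nlinarith

end Matrices

/-! ### The mean square deviation as a quadratic function -/

section Wick

variable {n : ℕ} {E : Type*} [NormedAddCommGroup E] [InnerProductSpace ℂ E]

/-- The Gram matrix, given by Wick's formula with covariance matrix `S`, of a unit vector `Ω` with
`X j` in the role of `ξ_j Ω` and `Y j k` in the role of `ξ_j ξ_k Ω`. -/
structure IsWickFamily (S : Matrix (Fin n) (Fin n) ℂ) (Ω : E) (X : Fin n → E)
    (Y : Fin n → Fin n → E) : Prop where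
  norm : ‖Ω‖ = 1
  inner_X : ∀ j, ⟪Ω, X j⟫_ℂ = 0
  inner_Y : ∀ j k, ⟪Ω, Y j k⟫_ℂ = S j k
  inner_X_X : ∀ j k, ⟪X j, X k⟫_ℂ = S j k
  inner_X_Y : ∀ j k l, ⟪X j, Y k l⟫_ℂ = 0
  inner_Y_Y : ∀ j k l m, ⟪Y j k, Y l m⟫_ℂ = S k j * S l m + S k l * S j m + S k m * S j l

/-- The vector `α Ω + ∑ β_j X_j + ∑ R_{jk} Y_{jk} / 2`. -/
noncomputable def quadVec (Ω : E) (X : Fin n → E) (Y : Fin n → Fin n → E) (α : ℝ)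
    (β : Fin n → ℝ) (R : Matrix (Fin n) (Fin n) ℝ) : E :=
  (α : ℂ) • Ω + ∑ j, (β j : ℂ) • X j + (1 / 2 : ℂ) • ∑ j, ∑ k, (R j k : ℂ) • Y j k

variable {Sg Θ : Matrix (Fin n) (Fin n) ℝ} {Ω : E} {X : Fin n → E} {Y : Fin n → Fin n → E}

/-- The antisymmetric part of `S` does not contribute to `⟨S, R⟩` for symmetric `R`. -/
theorem trace_mul_qcovMat_eq (hΘ : Θᵀ = -Θ) {R : Matrix (Fin n) (Fin n) ℝ} (hR : R.IsSymm) :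
    ∑ j, ∑ k, (R j k : ℂ) * qcovMat Sg Θ j k = ((Sg * R).trace : ℝ) := by
  have h0 : ∑ j, ∑ k, R j k * Θ j k = 0 := by
    have : ∑ j, ∑ k, R j k * Θ j k = ∑ j, ∑ k, -(R j k * Θ j k) := by
      rw [Finset.sum_comm]
      refine Finset.sum_congr rfl fun k _ => Finset.sum_congr rfl fun j _ => ?_
      have h1 := congrFun₂ hR k j
      have h2 := congrFun₂ hΘ k j
      simp only [transpose_apply, Matrix.neg_apply] at h1 h2
      rw [h1, h2]
      ring
    simp only [Finset.sum_neg_distrib] at this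
    linarith
  have h1 : (Sg * R).trace = ∑ j, ∑ k, R j k * Sg j k := by
    simp only [trace, diag_apply, mul_apply]
    refine Finset.sum_congr rfl fun j _ => Finset.sum_congr rfl fun k _ => ?_
    rw [show R k j = R j k from congrFun₂ hR j k]
    ring
  calc ∑ j, ∑ k, (R j k : ℂ) * qcovMat Sg Θ j k
      = ((∑ j, ∑ k, R j k * Sg j k : ℝ) : ℂ)
        + Complex.I / 2 * ((∑ j, ∑ k, R j k * Θ j k : ℝ) : ℂ) := by
        push_cast
        simp only [qcovMat_apply, Finset.mul_sum, ← Finset.sum_add_distrib]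
        refine Finset.sum_congr rfl fun j _ => Finset.sum_congr rfl fun k _ => ?_
        ring
    _ = _ := by rw [h0, h1]; simp

theorem IsWickFamily.norm_quadVec_sq (h : IsWickFamily (qcovMat Sg Θ) Ω X Y) (hSg : Sg.IsSymm)
    (hΘ : Θᵀ = -Θ) (α : ℝ) (β : Fin n → ℝ) {R : Matrix (Fin n) (Fin n) ℝ} (hR : R.IsSymm) :
    ‖quadVec Ω X Y α β R‖ ^ 2 = (α + (Sg * R).trace / 2) ^ 2 + β ⬝ᵥ Sg *ᵥ β
      + (R * kOp Sg Θ R).trace / 2 := by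
  set S := qcovMat Sg Θ with hS
  set B := ∑ j, (β j : ℂ) • X j with hB
  set C := ∑ j, ∑ k, (R j k : ℂ) • Y j k with hC
  have hRs : ∀ j k, R k j = R j k := fun j k => congrFun₂ hR j k
  have hΩΩ : ⟪Ω, Ω⟫_ℂ = 1 := by rw [inner_self_eq_norm_sq_to_K, h.norm]; simp
  have hΩB : ⟪Ω, B⟫_ℂ = 0 := by simp [hB, h.inner_X]
  have hBC : ⟪B, C⟫_ℂ = 0 := by
    simp [hB, hC, h.inner_X_Y]
  have hΩC : ⟪Ω, C⟫_ℂ = ((Sg * R).trace : ℝ) := by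
    simp only [hC, inner_sum, inner_smul_right, h.inner_Y]
    exact trace_mul_qcovMat_eq hΘ hR
  have hBB : (⟪B, B⟫_ℂ).re = β ⬝ᵥ Sg *ᵥ β := by
    simp only [hB, inner_sum, sum_inner, inner_smul_right, inner_smul_left, h.inner_X_X, hS,
      qcovMat_apply, Complex.conj_ofReal, Complex.re_sum, dotProduct, mulVec, Finset.mul_sum]
    rw [Finset.sum_comm]
    refine Finset.sum_congr rfl fun j _ => Finset.sum_congr rfl fun k _ => ?_
    simp
    ring
  have hCC : ⟪C, C⟫_ℂ = (((Sg * R).trace ^ 2 + 2 * (R * kOp Sg Θ R).trace : ℝ) : ℂ) := by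
    have e1 : ⟪C, C⟫_ℂ = ∑ j, ∑ k, ∑ l, ∑ m, (R j k : ℂ) * (R l m : ℂ) *
        (S k j * S l m + S k l * S j m + S k m * S j l) := by
      simp only [hC, inner_sum, sum_inner, inner_smul_right, inner_smul_left, h.inner_Y_Y,
        Complex.conj_ofReal, Finset.mul_sum]
      rw [Finset.sum_congr rfl fun l _ => Finset.sum_comm, Finset.sum_comm]
      refine Finset.sum_congr rfl fun j _ => ?_
      rw [Finset.sum_congr rfl fun l _ => Finset.sum_comm, Finset.sum_comm]
      refine Finset.sum_congr rfl fun k _ => ?_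
      refine Finset.sum_congr rfl fun l _ => Finset.sum_congr rfl fun m _ => ?_
      ring
    have e2 : ∑ j, ∑ k, ∑ l, ∑ m, (R j k : ℂ) * (R l m : ℂ) * (S k j * S l m)
        = ((Sg * R).trace : ℂ) ^ 2 := by
      rw [← trace_mul_qcovMat_eq hΘ hR, sq, Finset.sum_comm, Finset.sum_mul]
      refine Finset.sum_congr rfl fun k _ => ?_
      rw [Finset.sum_mul]
      refine Finset.sum_congr rfl fun j _ => ?_
      simp only [Finset.mul_sum]
      refine Finset.sum_congr rfl fun l _ => Finset.sum_congr rfl fun m _ => ?_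
      rw [hRs k j]
      ring
    have e3 : ∑ j, ∑ k, ∑ l, ∑ m, (R j k : ℂ) * (R l m : ℂ) * (S k l * S j m)
        = ((R * kOp Sg Θ R).trace : ℝ) := by
      rw [← trace_mul_qcovMat hSg hΘ]
      simp only [trace, diag_apply, mul_apply, transpose_apply, Finset.sum_mul, map_apply]
      refine Finset.sum_congr rfl fun j _ => ?_
      rw [Finset.sum_comm, Finset.sum_congr rfl fun l _ => Finset.sum_comm, Finset.sum_comm]
      refine Finset.sum_congr rfl fun m _ => Finset.sum_congr rfl fun l _ =>
        Finset.sum_congr rfl fun k _ => ?_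
      ring
    have e4 : ∑ j, ∑ k, ∑ l, ∑ m, (R j k : ℂ) * (R l m : ℂ) * (S k m * S j l)
        = ((R * kOp Sg Θ R).trace : ℝ) := by
      rw [← e3]
      refine Finset.sum_congr rfl fun j _ => Finset.sum_congr rfl fun k _ => ?_
      rw [Finset.sum_comm]
      refine Finset.sum_congr rfl fun l _ => Finset.sum_congr rfl fun m _ => ?_
      rw [hRs l m]
    rw [e1]
    simp only [mul_add, Finset.sum_add_distrib]
    rw [e2, e3, e4]
    push_cast
    ring
  have hre : ‖quadVec Ω X Y α β R‖ ^ 2 = (⟪quadVec Ω X Y α β R, quadVec Ω X Y α β R⟫_ℂ).re :=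
    (inner_self_eq_norm_sq (𝕜 := ℂ) _).symm
  have hBΩ : ⟪B, Ω⟫_ℂ = 0 := by rw [← inner_conj_symm, hΩB, map_zero]
  have hCB : ⟪C, B⟫_ℂ = 0 := by rw [← inner_conj_symm, hBC, map_zero]
  have hCΩ : ⟪C, Ω⟫_ℂ = ((Sg * R).trace : ℝ) := by
    rw [← inner_conj_symm, hΩC, Complex.conj_ofReal]
  rw [hre, quadVec, ← hB, ← hC]
  simp only [inner_add_left, inner_add_right, inner_smul_left, inner_smul_right, hΩΩ, hΩB, hBΩ,
    hΩC, hCΩ, hBC, hCB, hCC, Complex.add_re, hBB, mul_zero, Complex.conj_ofReal, mul_one,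
    Complex.zero_re, map_div₀, map_one, map_ofNat]
  rw [show (1 / 2 : ℂ) = ((1 / 2 : ℝ) : ℂ) by push_cast; rfl]
  simp only [Complex.add_re, Complex.re_ofReal_mul, Complex.ofReal_re, Complex.zero_re]
  ring

/-- The squared distance from `z` to a quadratic polynomial, for `z` orthogonal to `Ω`. -/
theorem IsWickFamily.norm_sub_quadVec_sq (h : IsWickFamily (qcovMat Sg Θ) Ω X Y)
    (hSg : Sg.IsSymm) (hΘ : Θᵀ = -Θ) {z : E} (hz : ⟪z, Ω⟫_ℂ = 0)
    {ε : Fin n → ℝ} (hε : ∀ j, (⟪z, X j⟫_ℂ).re = ε j)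
    {Γ : Matrix (Fin n) (Fin n) ℝ} (hΓ : ∀ j k, (⟪z, Y j k⟫_ℂ).re = Γ j k)
    (α : ℝ) (β : Fin n → ℝ) {R : Matrix (Fin n) (Fin n) ℝ} (hR : R.IsSymm) :
    ‖z - quadVec Ω X Y α β R‖ ^ 2 = ‖z‖ ^ 2 - 2 * (β ⬝ᵥ ε) - (R * Γ).trace
      + (α + (Sg * R).trace / 2) ^ 2 + β ⬝ᵥ Sg *ᵥ β + (R * kOp Sg Θ R).trace / 2 := by
  have hre : (⟪z, quadVec Ω X Y α β R⟫_ℂ).re = β ⬝ᵥ ε + (R * Γ).trace / 2 := by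
    have h1 : (R * Γ).trace = ∑ j, ∑ k, R j k * Γ j k := by
      rw [← trace_transpose, transpose_mul, hR.eq, trace_mul_comm]
      rfl
    rw [h1, quadVec, show (1 / 2 : ℂ) = ((1 / 2 : ℝ) : ℂ) by push_cast; rfl]
    simp only [inner_add_right, inner_smul_right, inner_sum, hz, Complex.add_re, Complex.re_sum,
      Complex.re_ofReal_mul, hε, hΓ, dotProduct, mul_zero, Complex.zero_re]
    ring
  rw [@norm_sub_sq ℂ, h.norm_quadVec_sq hSg hΘ α β hR]
  change ‖z‖ ^ 2 - 2 * (⟪z, quadVec Ω X Y α β R⟫_ℂ).re + _ = _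
  rw [hre]
  ring

end Wick

/-! ### The graph of an unbounded operator -/

section Acts

variable {𝓗 : Type*} [NormedAddCommGroup 𝓗] [InnerProductSpace ℂ 𝓗]
  {A B : 𝓗 →ₗ.[ℂ] 𝓗} {v w z : 𝓗}

/-- `v` lies in the domain of `A` and `A v = w`. -/
def Acts (A : 𝓗 →ₗ.[ℂ] 𝓗) (v w : 𝓗) : Prop := ∃ h : v ∈ A.domain, A ⟨v, h⟩ = w

namespace Acts

theorem app_eq (h : Acts A v w) : app A v = w := by
  obtain ⟨hv, rfl⟩ := h
  simp [app, hv]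

theorem of_mem (h : v ∈ A.domain) : Acts A v (app A v) := ⟨h, by simp [app, h]⟩

theorem idOp (v : 𝓗) : Acts idOp v v := ⟨trivial, rfl⟩

theorem add (hA : Acts A v w) (hB : Acts B v z) : Acts (A + B) v (w + z) := by
  obtain ⟨h1, rfl⟩ := hA
  obtain ⟨h2, rfl⟩ := hB
  exact ⟨⟨h1, h2⟩, LinearPMap.add_apply A B ⟨v, h1, h2⟩⟩

theorem sub (hA : Acts A v w) (hB : Acts B v z) : Acts (A - B) v (w - z) := by
  obtain ⟨h1, rfl⟩ := hA
  obtain ⟨h2, rfl⟩ := hB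
  exact ⟨⟨h1, h2⟩, LinearPMap.sub_apply A B ⟨v, h1, h2⟩⟩

theorem smul (c : ℂ) (hA : Acts A v w) : Acts (c • A) v (c • w) := by
  obtain ⟨h1, rfl⟩ := hA
  exact ⟨h1, rfl⟩

theorem sum {κ : Type*} (s : Finset κ) {A : κ → 𝓗 →ₗ.[ℂ] 𝓗} {w : κ → 𝓗}
    (h : ∀ i ∈ s, Acts (A i) v (w i)) : Acts (∑ i ∈ s, A i) v (∑ i ∈ s, w i) := by
  classical
  induction s using Finset.induction_on with
  | empty => exact ⟨trivial, rfl⟩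
  | insert i s his ih =>
    rw [Finset.sum_insert his, Finset.sum_insert his]
    exact (h i (Finset.mem_insert_self i s)).add
      (ih fun j hj => h j (Finset.mem_insert_of_mem hj))

theorem mulOp (hB : Acts B v w) (hA : Acts A w z) : Acts (mulOp A B) v z := by
  obtain ⟨h1, rfl⟩ := hB
  obtain ⟨h2, rfl⟩ := hA
  exact ⟨⟨h1, h2⟩, rfl⟩

theorem vec_smul (c : ℂ) (hA : Acts A v w) : Acts A (c • v) (c • w) := by
  obtain ⟨h1, rfl⟩ := hA
  exact ⟨A.domain.smul_mem c h1, A.map_smul c ⟨v, h1⟩⟩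

theorem vec_add {v' w' : 𝓗} (h : Acts A v w) (h' : Acts A v' w') : Acts A (v + v') (w + w') := by
  obtain ⟨h1, rfl⟩ := h
  obtain ⟨h2, rfl⟩ := h'
  exact ⟨A.domain.add_mem h1 h2, A.map_add ⟨v, h1⟩ ⟨v', h2⟩⟩

theorem of_sub_smul_idOp {c : ℂ} (h : Acts (A - c • QuantumQuad.idOp) v w) :
    Acts A v (w + c • v) := by
  obtain ⟨⟨h1, h2⟩, rfl⟩ := h
  refine ⟨h1, ?_⟩
  have := LinearPMap.sub_apply A (c • QuantumQuad.idOp) ⟨v, h1, h2⟩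
  rw [this]
  exact (sub_add_cancel (A ⟨v, h1⟩) (c • v)).symm

theorem toPMap_top (T : 𝓗 →ₗ[ℂ] 𝓗) (v : 𝓗) : Acts (T.toPMap ⊤) v (T v) := ⟨trivial, rfl⟩

end Acts

/-- A self-adjoint operator `A` with `t ↦ T t v` of derivative `i A v` at `0` on its domain, for
a unitary group `T`, is all of the generator of `T`: the generator is a symmetric extension of `A`,
and a self-adjoint operator has no proper one. -/
theorem acts_of_hasDerivAt [CompleteSpace 𝓗] (hA : IsSelfAdjoint A) {T : ℝ → 𝓗 →L[ℂ] 𝓗}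
    (hT : ∀ t v w, ⟪T t v, w⟫_ℂ = ⟪v, T (-t) w⟫_ℂ)
    (hd : ∀ v : A.domain, HasDerivAt (fun t : ℝ => T t v) (Complex.I • A v) 0)
    (h : HasDerivAt (fun t : ℝ => T t v) w 0) : Acts A v (-Complex.I • w) := by
  have hin : ∀ u : A.domain, ⟪-Complex.I • w, (u : 𝓗)⟫_ℂ = ⟪v, A u⟫_ℂ := by
    intro u
    have h1 : HasDerivAt (fun t : ℝ => ⟪T t v, (u : 𝓗)⟫_ℂ) ⟪w, (u : 𝓗)⟫_ℂ 0 := by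
      simpa using h.inner ℂ (hasDerivAt_const (0 : ℝ) (u : 𝓗))
    have h2 : HasDerivAt (fun t : ℝ => T (-t) (u : 𝓗)) (-(Complex.I • A u)) 0 := by
      have := HasDerivAt.scomp (0 : ℝ) (h := fun t : ℝ => -t) (h' := -1)
        (g₁ := fun t : ℝ => T t (u : 𝓗)) (by simpa using hd u) (hasDerivAt_neg 0)
      simpa [Function.comp_def] using this
    have h3 : HasDerivAt (fun t : ℝ => ⟪v, T (-t) (u : 𝓗)⟫_ℂ) ⟪v, -(Complex.I • A u)⟫_ℂ 0 := by
      simpa using (hasDerivAt_const (0 : ℝ) v).inner ℂ h2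
    have h4 := h1.unique (h3.congr_of_eventuallyEq (.of_forall fun t => hT t v u))
    rw [inner_smul_left, h4, inner_neg_right, inner_smul_right, map_neg, Complex.conj_I,
      neg_neg, mul_neg, ← mul_assoc, Complex.I_mul_I]
    ring
  have hdom : v ∈ (LinearPMap.adjoint A).domain :=
    LinearPMap.mem_adjoint_domain_of_exists v ⟨_, hin⟩
  have hval := LinearPMap.adjoint_apply_eq hA.dense_domain ⟨v, hdom⟩ hin
  have hact : Acts (LinearPMap.adjoint A) v (-Complex.I • w) := ⟨hdom, hval⟩
  rwa [LinearPMap.isSelfAdjoint_def.1 hA] at hact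

theorem Acts.inner_comm [CompleteSpace 𝓗] (hA : IsSelfAdjoint A) (h : Acts A v w) :
    ⟪v, w⟫_ℂ = ⟪w, v⟫_ℂ := by
  obtain ⟨hv, rfl⟩ := h
  have hf := LinearPMap.adjoint_isFormalAdjoint hA.dense_domain
  rw [LinearPMap.isSelfAdjoint_def.1 hA] at hf
  exact (hf ⟨v, hv⟩ ⟨v, hv⟩).symm

end Acts

/-! ### The Hilbert space of a density operator -/

section Purification

variable {ι 𝓗 : Type*} [NormedAddCommGroup 𝓗]

variable (ι 𝓗) in
/-- The direct sum of copies of `𝓗` indexed by the eigenbasis of a density operator `ρ`. The family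
`(√p_i A e_i)` is a vector of this space exactly if `A` has a finite second moment, and its inner
products with other such vectors are the expectations with respect to `ρ`. -/
abbrev EigenSum : Type _ := lp (fun _ : ι => 𝓗) 2

theorem memℓp_two_iff {f : ι → 𝓗} : Memℓp f 2 ↔ Summable fun i => ‖f i‖ ^ 2 := by
  rw [memℓp_gen_iff (by norm_num)]
  norm_num

theorem EigenSum.norm_sq_eq_tsum (Φ : EigenSum ι 𝓗) : ‖Φ‖ ^ 2 = ∑' i, ‖Φ i‖ ^ 2 := by
  have := lp.norm_rpow_eq_tsum (p := 2) (by norm_num) Φ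
  norm_num at this
  exact this

variable [InnerProductSpace ℂ 𝓗]

/-- The bounded operator `T` acting in each summand. -/
noncomputable def diagOp (T : 𝓗 →L[ℂ] 𝓗) : EigenSum ι 𝓗 →L[ℂ] EigenSum ι 𝓗 :=
  have hle : ∀ Φ : EigenSum ι 𝓗, ∀ i, ‖T (Φ i)‖ ^ 2 ≤ ‖T‖ ^ 2 * ‖Φ i‖ ^ 2 := fun Φ i => by
    rw [← mul_pow]
    exact pow_le_pow_left₀ (norm_nonneg _) (T.le_opNorm _) 2
  have hsum : ∀ Φ : EigenSum ι 𝓗, Summable fun i => ‖T‖ ^ 2 * ‖Φ i‖ ^ 2 := fun Φ =>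
    (memℓp_two_iff.1 (lp.memℓp Φ)).mul_left _
  LinearMap.mkContinuous
    { toFun := fun Φ => ⟨fun i => T (Φ i), memℓp_two_iff.2
        (.of_nonneg_of_le (fun _ => sq_nonneg _) (hle Φ) (hsum Φ))⟩
      map_add' := fun Φ Ψ => lp.ext (funext fun i => T.map_add (Φ i) (Ψ i))
      map_smul' := fun c Φ => lp.ext (funext fun i => T.map_smul c (Φ i)) }
    ‖T‖ fun Φ => by
      refine le_of_sq_le_sq ?_ (by positivity)
      rw [EigenSum.norm_sq_eq_tsum, mul_pow, EigenSum.norm_sq_eq_tsum, ← tsum_mul_left]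
      exact Summable.tsum_le_tsum (hle Φ)
        (.of_nonneg_of_le (fun _ => sq_nonneg _) (hle Φ) (hsum Φ)) (hsum Φ)

@[simp]
theorem diagOp_apply (T : 𝓗 →L[ℂ] 𝓗) (Φ : EigenSum ι 𝓗) (i : ι) : diagOp T Φ i = T (Φ i) := rfl

/-- The operator `A`, acting in each summand, maps `Φ` to `Ψ`. -/
def Lifts (A : 𝓗 →ₗ.[ℂ] 𝓗) (Φ Ψ : EigenSum ι 𝓗) : Prop := ∀ i, Acts A (Φ i) (Ψ i)

theorem Lifts.inner_comm [CompleteSpace 𝓗] {A : 𝓗 →ₗ.[ℂ] 𝓗} (hA : IsSelfAdjoint A)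
    {Φ Ψ : EigenSum ι 𝓗} (h : Lifts A Φ Ψ) : ⟪Φ, Ψ⟫_ℂ = ⟪Ψ, Φ⟫_ℂ := by
  rw [lp.inner_eq_tsum, lp.inner_eq_tsum]
  exact tsum_congr fun i => (h i).inner_comm hA

namespace DensityOperator

variable (ρ : DensityOperator ι 𝓗)

/-- The vector `(√p_i e_i)`, which represents `ρ` in the direct sum. -/
noncomputable def vacuum : EigenSum ι 𝓗 :=
  ⟨fun i => (√(ρ.prob i) : ℂ) • ρ.basis i, memℓp_two_iff.2 (by
    simpa [norm_smul, mul_pow, Real.sq_sqrt (ρ.prob_nonneg _), ρ.basis.orthonormal.1,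
      abs_of_nonneg] using ρ.hasSum_prob.summable)⟩

theorem vacuum_apply (i : ι) : ρ.vacuum i = (√(ρ.prob i) : ℂ) • ρ.basis i := rfl

theorem norm_vacuum : ‖ρ.vacuum‖ = 1 := by
  have h : ‖ρ.vacuum‖ ^ 2 = 1 := by
    rw [EigenSum.norm_sq_eq_tsum, ← ρ.hasSum_prob.tsum_eq]
    refine tsum_congr fun i => ?_
    simp [vacuum_apply, norm_smul, Real.sq_sqrt (ρ.prob_nonneg _),
      ρ.basis.orthonormal.1]
  exact (pow_eq_one_iff_of_nonneg (norm_nonneg _) two_ne_zero).1 h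

variable {ρ} {A B : 𝓗 →ₗ.[ℂ] 𝓗} {Φ Ψ : EigenSum ι 𝓗}

theorem sqrt_prob_mul_self (i : ι) : (√(ρ.prob i) : ℂ) * √(ρ.prob i) = ρ.prob i := by
  rw [← Complex.ofReal_mul, Real.mul_self_sqrt (ρ.prob_nonneg i)]

theorem mem_domain_of_lifts (h : Lifts A ρ.vacuum Φ) {i : ι} (hi : ρ.prob i ≠ 0) :
    ρ.basis i ∈ A.domain := by
  obtain ⟨hm, -⟩ := h i
  rw [vacuum_apply] at hm
  have h0 : (√(ρ.prob i) : ℂ) ≠ 0 := by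
    rw [Complex.ofReal_ne_zero, Real.sqrt_ne_zero (ρ.prob_nonneg i)]
    exact hi
  exact (A.domain.smul_mem_iff h0).1 hm

theorem eq_smul_app_of_lifts (h : Lifts A ρ.vacuum Φ) (i : ι) :
    Φ i = (√(ρ.prob i) : ℂ) • app A (ρ.basis i) := by
  by_cases hi : ρ.prob i = 0
  · have h0 := h i
    rw [vacuum_apply, hi] at h0
    obtain ⟨hm, hv⟩ := h0
    rw [← hv, hi]
    have : (⟨_, hm⟩ : A.domain) = 0 := Subtype.ext (by simp)
    rw [this, A.map_zero]
    simp
  · have h1 := (Acts.of_mem (mem_domain_of_lifts h hi)).vec_smul (√(ρ.prob i) : ℂ)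
    rw [← vacuum_apply] at h1
    rw [← (h i).app_eq, h1.app_eq]

theorem finiteSecondMoment_of_lifts (h : Lifts A ρ.vacuum Φ) : ρ.FiniteSecondMoment A := by
  refine ⟨fun i hi => mem_domain_of_lifts h hi, ?_⟩
  refine (memℓp_two_iff.1 (lp.memℓp Φ)).congr fun i => ?_
  rw [eq_smul_app_of_lifts h i, norm_smul, mul_pow, Complex.norm_real, Real.norm_eq_abs, sq_abs,
    Real.sq_sqrt (ρ.prob_nonneg i)]

theorem FiniteSecondMoment.exists_lifts (h : ρ.FiniteSecondMoment A) :
    ∃ Φ, Lifts A ρ.vacuum Φ := by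
  refine ⟨⟨fun i => (√(ρ.prob i) : ℂ) • app A (ρ.basis i), memℓp_two_iff.2 ?_⟩, fun i => ?_⟩
  · refine h.2.congr fun i => ?_
    rw [norm_smul, mul_pow, Complex.norm_real, Real.norm_eq_abs, sq_abs,
      Real.sq_sqrt (ρ.prob_nonneg i)]
  · change Acts A ((√(ρ.prob i) : ℂ) • ρ.basis i) ((√(ρ.prob i) : ℂ) • app A (ρ.basis i))
    by_cases hi : ρ.prob i = 0
    · rw [hi]
      simp only [Real.sqrt_zero, Complex.ofReal_zero, zero_smul]
      exact ⟨A.domain.zero_mem, A.map_zero⟩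
    · exact (Acts.of_mem (h.1 i hi)).vec_smul _

theorem expectMul_eq_inner (hA : Lifts A ρ.vacuum Φ) (hB : Lifts B ρ.vacuum Ψ) :
    ρ.expectMul A B = ⟪Φ, Ψ⟫_ℂ := by
  rw [lp.inner_eq_tsum, expectMul]
  refine tsum_congr fun i => ?_
  rw [eq_smul_app_of_lifts hA i, eq_smul_app_of_lifts hB i, inner_smul_left, inner_smul_right,
    Complex.conj_ofReal, ← mul_assoc, sqrt_prob_mul_self]

theorem expect_eq_inner (hA : Lifts A ρ.vacuum Φ) : ρ.expect A = ⟪ρ.vacuum, Φ⟫_ℂ := by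
  rw [lp.inner_eq_tsum, expect]
  refine tsum_congr fun i => ?_
  rw [eq_smul_app_of_lifts hA i, vacuum_apply, inner_smul_left, inner_smul_right,
    Complex.conj_ofReal, ← mul_assoc, sqrt_prob_mul_self]

theorem meanSq_eq_norm_sq (hA : Lifts A ρ.vacuum Φ) : ρ.meanSq A = ‖Φ‖ ^ 2 := by
  rw [EigenSum.norm_sq_eq_tsum, meanSq]
  refine tsum_congr fun i => ?_
  rw [eq_smul_app_of_lifts hA i, norm_smul, mul_pow, Complex.norm_real, Real.norm_eq_abs, sq_abs,
    Real.sq_sqrt (ρ.prob_nonneg i)]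

theorem lifts_centered (hA : Lifts A ρ.vacuum Φ) :
    Lifts (ρ.centered A) ρ.vacuum (Φ - ρ.expect A • ρ.vacuum) :=
  fun i => (hA i).sub ((Acts.idOp (ρ.vacuum i)).smul (ρ.expect A))

theorem sig_isSymm {n : ℕ} (x : Fin n → 𝓗 →ₗ.[ℂ] 𝓗) : (ρ.sig x).IsSymm := by
  ext j k
  rw [Matrix.transpose_apply, sig, sig, expectMul, expectMul, ← Complex.conj_re,
    Complex.conj_tsum]
  congr 2
  ext i
  rw [map_mul, inner_conj_symm, Complex.conj_ofReal]

end DensityOperator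

/-- A quadratic polynomial of operators, applied to a vector. -/
theorem lifts_quadOp {n : ℕ} {y : Fin n → 𝓗 →ₗ.[ℂ] 𝓗} {Ω : EigenSum ι 𝓗}
    {X : Fin n → EigenSum ι 𝓗} {Y : Fin n → Fin n → EigenSum ι 𝓗}
    (hX : ∀ j, Lifts (y j) Ω (X j)) (hY : ∀ j k, Lifts (y j) (X k) (Y j k))
    (α : ℝ) (β : Fin n → ℝ) (R : Matrix (Fin n) (Fin n) ℝ) :
    Lifts (quadOp y α β R) Ω (quadVec Ω X Y α β R) := by
  intro i
  have h1 := (Acts.idOp (Ω i)).smul (α : ℂ)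
  have h2 := Acts.sum Finset.univ fun j _ => (hX j i).smul (β j : ℂ)
  have h3 := (Acts.sum Finset.univ fun j _ => Acts.sum Finset.univ fun k _ =>
    ((hX k i).mulOp (hY j k i)).smul (R j k : ℂ)).smul (1 / 2 : ℂ)
  have h4 := (h1.add h2).add h3
  have h5 : quadVec Ω X Y α β R i = (α : ℂ) • Ω i + ∑ j, (β j : ℂ) • X j i
      + (1 / 2 : ℂ) • ∑ j, ∑ k, (R j k : ℂ) • Y j k i := by
    change lp.evalCLM ℂ (fun _ : ι => 𝓗) 2 i (quadVec Ω X Y α β R) = _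
    simp only [quadVec, map_add, map_sum, map_smul]
    rfl
  rw [h5]
  exact h4

end Purification

/-! ### Gaussian states of a Weyl system -/

section WeylSystem

variable {n : ℕ} {ι 𝓗 : Type*} [NormedAddCommGroup 𝓗] [InnerProductSpace ℂ 𝓗]
  {x : Fin n → 𝓗 →ₗ.[ℂ] 𝓗} {Θ : Matrix (Fin n) (Fin n) ℝ} {W : (Fin n → ℝ) → 𝓗 →L[ℂ] 𝓗}

namespace IsWeylSystem

theorem map_zero (hW : IsWeylSystem x Θ W) (v : 𝓗) : W 0 v = v := by
  have hinj : Function.Injective (W 0) := by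
    refine (injective_iff_map_eq_zero (W 0)).2 fun w hw => ?_
    rw [← norm_eq_zero, ← hW.norm_map 0, hw, norm_zero]
  apply hinj
  rw [hW.weyl]
  simp

theorem inner_map (hW : IsWeylSystem x Θ W) (u : Fin n → ℝ) (v w : 𝓗) :
    ⟪W u v, W u w⟫_ℂ = ⟪v, w⟫_ℂ :=
  (LinearMap.norm_map_iff_inner_map_map (W u)).1 (hW.norm_map u) v w

theorem inner_apply_left (hW : IsWeylSystem x Θ W) (hΘ : Θᵀ = -Θ) (u : Fin n → ℝ) (v w : 𝓗) :
    ⟪W u v, w⟫_ℂ = ⟪v, W (-u) w⟫_ℂ := by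
  rw [← hW.inner_map (-u), hW.weyl, neg_add_cancel, hW.map_zero, neg_dotProduct,
    dotProduct_mulVec_self_of_antisymm hΘ]
  simp

/-- A vector at which the centered group `t ↦ exp (- i t μ_j) W (t e_j)` is differentiable lies in
the domain of `x_j - μ_j`. -/
theorem acts_sub_of_hasDerivAt [CompleteSpace 𝓗] (hW : IsWeylSystem x Θ W) (hΘ : Θᵀ = -Θ)
    (hx : ∀ j, IsSelfAdjoint (x j)) (μ : Fin n → ℝ) (j : Fin n) {v w : 𝓗}
    (h : HasDerivAt (fun t : ℝ =>
      (Complex.exp (-(Complex.I * ((t • Pi.single j 1 ⬝ᵥ μ : ℝ) : ℂ))) •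
        W (t • Pi.single j 1)) v) w 0) :
    Acts (x j - (μ j : ℂ) • idOp) v (-Complex.I • w) := by
  have hexp : HasDerivAt (fun t : ℝ => Complex.exp (Complex.I * (μ j : ℂ) * t))
      (Complex.I * μ j) 0 := by
    have hi : HasDerivAt (fun t : ℝ => (t : ℂ)) 1 0 := Complex.ofRealCLM.hasDerivAt
    simpa using (hi.const_mul (Complex.I * (μ j : ℂ))).cexp
  have h1 := hexp.smul h
  have h2 : HasDerivAt (fun t : ℝ => W (t • Pi.single j 1) v)
      (w + (Complex.I * μ j) • v) 0 := by
    refine (h1.congr_deriv ?_).congr_of_eventuallyEq (.of_forall fun t => ?_)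
    · simp [hW.map_zero]
    · simp only [_root_.smul_apply, smul_smul, ← Complex.exp_add, smul_dotProduct,
        single_dotProduct, Pi.smul_apply', smul_eq_mul, one_mul]
      rw [show Complex.I * (μ j : ℂ) * t + -(Complex.I * ((t * μ j : ℝ) : ℂ)) = 0 by
        push_cast; ring]
      simp
  have h3 := acts_of_hasDerivAt (hx j) (T := fun t => W (t • Pi.single j 1))
    (fun t v w => by rw [hW.inner_apply_left hΘ, neg_smul]) (hW.hasDerivAt j) h2
  have h4 := h3.sub ((Acts.idOp v).smul (μ j : ℂ))
  convert h4 using 1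
  rw [smul_add, smul_smul, ← mul_assoc, neg_mul, Complex.I_mul_I, neg_neg, one_mul,
    add_sub_cancel_right]

end IsWeylSystem

/-- In a Gaussian state, the vector of the state is a Gaussian vector of the centered Weyl system,
acting in each summand. -/
theorem isGaussianVector_of_isGaussian (hW : IsWeylSystem x Θ W) (hΘ : Θᵀ = -Θ)
    {ρ : DensityOperator ι 𝓗} (hρ : ρ.IsGaussian x W) :
    IsGaussianVector (toBilin' (ρ.sig x)) (toBilin' Θ)
      (fun u => diagOp (Complex.exp (-(Complex.I * ((u ⬝ᵥ ρ.meanVec x : ℝ) : ℂ))) • W u))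
      ρ.vacuum where
  symm u v := by
    rw [toBilin'_apply', toBilin'_apply', dotProduct_mulVec, ← mulVec_transpose,
      DensityOperator.sig_isSymm x, dotProduct_comm]
  antisymm u v := by
    rw [toBilin'_apply', toBilin'_apply', dotProduct_mulVec, ← mulVec_transpose, hΘ,
      dotProduct_comm, neg_mulVec, dotProduct_neg]
  map_zero Φ := lp.ext (funext fun i => by simp [hW.map_zero])
  inner_map u Φ Ψ := by
    rw [lp.inner_eq_tsum, lp.inner_eq_tsum]
    refine tsum_congr fun i => ?_
    simp only [diagOp_apply, _root_.smul_apply, inner_smul_left, inner_smul_right,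
      hW.inner_map, ← Complex.exp_conj, ← mul_assoc, ← Complex.exp_add]
    simp
  weyl u u' Φ := lp.ext (funext fun i => by
    simp only [diagOp_apply, lp.coeFn_smul, Pi.smul_apply, _root_.smul_apply,
      map_smul, hW.weyl, smul_smul, ← Complex.exp_add, toBilin'_apply', add_dotProduct]
    congr 2
    push_cast
    ring)
  gauss u := by
    rw [← DensityOperator.expect_eq_inner (A := LinearMap.toPMap
      (Complex.exp (-(Complex.I * ((u ⬝ᵥ ρ.meanVec x : ℝ) : ℂ))) • W u : 𝓗 →L[ℂ] 𝓗).toLinearMap ⊤)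
      fun i => Acts.toPMap_top _ _, toBilin'_apply']
    exact hρ u

/-- The derivative of a curve, read off in one coordinate. -/
theorem hasDerivAt_clm_apply {E : Type*} [NormedAddCommGroup E] [InnerProductSpace ℂ E]
    (c : E →L[ℂ] 𝓗) {γ : ℝ → E} {D : E} (h : HasDerivAt γ D 0) :
    HasDerivAt (fun t => c (γ t)) (c D) 0 :=
  (c.restrictScalars ℝ).hasFDerivAt.comp_hasDerivAt 0 h

theorem qform_single (Sg Θ : Matrix (Fin n) (Fin n) ℝ) (j k : Fin n) :
    qform (toBilin' Sg) (toBilin' Θ) (Pi.single j 1) (Pi.single k 1) = qcovMat Sg Θ j k := by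
  simp [qform, qcovMat_apply, toBilin'_apply']

/-- In a Gaussian state the products of at most two of the `ξ_j` have finite second moments, and
the mixed moments of these products are given by Wick's formula. -/
theorem exists_isWickFamily [CompleteSpace 𝓗] (hx : ∀ j, IsSelfAdjoint (x j)) (hΘ : Θᵀ = -Θ)
    (hW : IsWeylSystem x Θ W) {ρ : DensityOperator ι 𝓗} (hρ : ρ.IsGaussian x W) :
    (∀ j, ρ.expect (x j) = ρ.meanVec x j) ∧ ∃ X Y,
      (∀ j, Lifts (ρ.xi x j) ρ.vacuum (X j)) ∧ (∀ j k, Lifts (ρ.xi x j) (X k) (Y j k)) ∧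
      IsWickFamily (qcovMat (ρ.sig x) Θ) ρ.vacuum X Y := by
  have hG := isGaussianVector_of_isGaussian hW hΘ hρ
  choose D hD using fun j : Fin n => hG.exists_hasDerivAt_vacuum (Pi.single j 1)
  choose D₂ hD₂ using fun j k : Fin n => hG.exists_hasDerivAt_deriv (hD k) (Pi.single j 1)
  have hy : ∀ j, Lifts (x j - (ρ.meanVec x j : ℂ) • idOp) ρ.vacuum (-Complex.I • D j) :=
    fun j i => hW.acts_sub_of_hasDerivAt hΘ hx _ j
      (hasDerivAt_clm_apply (lp.evalCLM ℂ (fun _ : ι => 𝓗) 2 i) (hD j))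
  have hy₂ : ∀ j k, Lifts (x j - (ρ.meanVec x j : ℂ) • idOp) (-Complex.I • D k) (-D₂ j k) := by
    intro j k i
    have h := (hW.acts_sub_of_hasDerivAt hΘ hx (ρ.meanVec x) j
      (hasDerivAt_clm_apply (lp.evalCLM ℂ (fun _ : ι => 𝓗) 2 i) (hD₂ j k))).vec_smul (-Complex.I)
    rw [smul_smul, neg_mul_neg, Complex.I_mul_I, neg_one_smul] at h
    exact h
  have hΩD : ∀ j, ⟪ρ.vacuum, D j⟫_ℂ = 0 := fun j => by
    have h := hG.inner_vacuum_deriv (hD j) 0 0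
    simp only [hG.map_zero, sub_self, zero_mul] at h
    exact h
  have hΩΩ : ⟪ρ.vacuum, ρ.vacuum⟫_ℂ = 1 := by
    rw [inner_self_eq_norm_sq_to_K, ρ.norm_vacuum]
    simp
  have hmean : ∀ j, ρ.expect (x j) = ρ.meanVec x j := by
    intro j
    have h : Lifts (x j) ρ.vacuum (-Complex.I • D j + (ρ.meanVec x j : ℂ) • ρ.vacuum) :=
      fun i => (hy j i).of_sub_smul_idOp
    rw [DensityOperator.expect_eq_inner h, inner_add_right, inner_smul_right, inner_smul_right,
      hΩD, hΩΩ]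
    simp
  have hxi : ∀ j, ρ.xi x j = x j - (ρ.meanVec x j : ℂ) • idOp := fun j => by
    rw [DensityOperator.xi, DensityOperator.centered, hmean]
  refine ⟨hmean, fun j => -Complex.I • D j, fun j k => -D₂ j k, fun j => ?_, fun j k => ?_, ?_⟩
  · rw [hxi]
    exact hy j
  · rw [hxi]
    exact hy₂ j k
  · refine ⟨ρ.norm_vacuum, fun j => ?_, fun j k => ?_, fun j k => ?_, fun j k l => ?_,
      fun j k l m => ?_⟩
    · rw [inner_smul_right, hΩD, mul_zero]
    · rw [inner_neg_right, hG.inner_vacuum_deriv₂ (hD k) (hD₂ j k), neg_neg, qform_single]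
    · have h := hG.inner_deriv_deriv (hD j) (hD k) 0 0
      simp only [hG.map_zero, qform_single] at h
      rw [inner_smul_left, inner_smul_right, h]
      simp [qform, ← mul_assoc]
    · rw [inner_smul_left, inner_neg_right, hG.inner_deriv_deriv₂ (hD j) (hD l) (hD₂ k l)]
      simp
    · rw [inner_neg_left, inner_neg_right, neg_neg,
        hG.inner_deriv₂_deriv₂ (hD k) (hD₂ j k) (hD m) (hD₂ l m)]
      simp only [qform_single]

/-- The commutation relation `ξ_j ξ_k - ξ_k ξ_j = i θ_{jk}`, on the vector of the state, follows
from the moments alone: the difference of both sides has norm zero. -/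
theorem IsWickFamily.commutator {E : Type*} [NormedAddCommGroup E] [InnerProductSpace ℂ E]
    {S : Matrix (Fin n) (Fin n) ℂ} {Ω : E} {X : Fin n → E} {Y : Fin n → Fin n → E}
    (h : IsWickFamily S Ω X Y) (j k : Fin n) : Y j k - Y k j = (S j k - S k j) • Ω := by
  have hΩΩ : ⟪Ω, Ω⟫_ℂ = 1 := by rw [inner_self_eq_norm_sq_to_K, h.norm]; simp
  have hYΩ : ∀ j k, ⟪Y j k, Ω⟫_ℂ = S k j := fun j k => by
    rw [← inner_conj_symm, h.inner_Y, ← h.inner_X_X, inner_conj_symm, h.inner_X_X]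
  have hS : ∀ j k, star (S j k) = S k j := fun j k => by
    rw [← h.inner_X_X, ← h.inner_X_X, RCLike.star_def, inner_conj_symm]
  rw [← sub_eq_zero, ← inner_self_eq_zero (𝕜 := ℂ)]
  simp only [inner_sub_left, inner_sub_right, inner_smul_left, inner_smul_right, h.inner_Y_Y,
    h.inner_Y, hYΩ, hΩΩ, map_sub, ← RCLike.star_def, hS]
  ring

theorem IsWickFamily.posDef {E : Type*} [NormedAddCommGroup E] [InnerProductSpace ℂ E]
    {S : Matrix (Fin n) (Fin n) ℂ} {Ω : E} {X : Fin n → E} {Y : Fin n → Fin n → E}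
    (h : IsWickFamily S Ω X Y) (hS : IsUnit S.det) : S.PosDef := by
  have hgram : S = gram ℂ X := by
    ext j k
    rw [gram_apply, h.inner_X_X]
  have hpsd : S.PosSemidef := hgram ▸ posSemidef_gram ℂ X
  exact hpsd.posDef_iff_det_ne_zero.2 hS.ne_zero

/-- Translation of the argument of a quadratic polynomial by `μ`. -/
theorem quadVec_translate {E : Type*} [NormedAddCommGroup E] [InnerProductSpace ℂ E]
    (Ω : E) (X : Fin n → E) (Y : Fin n → Fin n → E) (μ : Fin n → ℝ) (a : ℝ) (b : Fin n → ℝ)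
    {R : Matrix (Fin n) (Fin n) ℝ} (hR : R.IsSymm) :
    quadVec Ω (fun j => X j + (μ j : ℂ) • Ω)
      (fun j k => Y j k + (μ j : ℂ) • X k + (μ k : ℂ) • (X j + (μ j : ℂ) • Ω)) a b R
      = quadVec Ω X Y (a + b ⬝ᵥ μ + μ ⬝ᵥ R *ᵥ μ / 2) (b + R *ᵥ μ) R := by
  have h1 : ∑ j, ∑ k, (R j k : ℂ) • (μ j : ℂ) • X k
      = ∑ j, ∑ k, (R j k : ℂ) • (μ k : ℂ) • X j := by
    rw [Finset.sum_comm]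
    refine Finset.sum_congr rfl fun k _ => Finset.sum_congr rfl fun j _ => ?_
    rw [show R j k = R k j from congrFun₂ hR k j]
  have h2 : ∑ j, ((R *ᵥ μ) j : ℂ) • X j = ∑ j, ∑ k, (R j k : ℂ) • (μ k : ℂ) • X j := by
    refine Finset.sum_congr rfl fun j _ => ?_
    simp only [mulVec, dotProduct, Complex.ofReal_sum, Complex.ofReal_mul, Finset.sum_smul,
      mul_smul]
  have h3 : ∑ j, ∑ k, (R j k : ℂ) • (μ k : ℂ) • (μ j : ℂ) • Ω = ((μ ⬝ᵥ R *ᵥ μ : ℝ) : ℂ) • Ω := by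
    simp only [mulVec, dotProduct, Complex.ofReal_sum, Complex.ofReal_mul, Finset.sum_smul,
      Finset.mul_sum, smul_smul]
    refine Finset.sum_congr rfl fun j _ => Finset.sum_congr rfl fun k _ => ?_
    congr 1
    ring
  have h4 : ∑ j, (b j : ℂ) • (μ j : ℂ) • Ω = ((b ⬝ᵥ μ : ℝ) : ℂ) • Ω := by
    simp only [dotProduct, Complex.ofReal_sum, Complex.ofReal_mul, Finset.sum_smul, smul_smul]
  simp only [quadVec, smul_add, Finset.sum_add_distrib, h1, h3, h4, Pi.add_apply,
    Complex.ofReal_add, add_smul, h2, Complex.ofReal_div, Complex.ofReal_ofNat]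
  module

theorem quadVec_sub_smul {E : Type*} [NormedAddCommGroup E] [InnerProductSpace ℂ E]
    (Ω : E) (X : Fin n → E) (Y : Fin n → Fin n → E) (α c : ℝ) (β : Fin n → ℝ)
    (R : Matrix (Fin n) (Fin n) ℝ) :
    quadVec Ω X Y (α - c) β R = quadVec Ω X Y α β R - (c : ℂ) • Ω := by
  simp only [quadVec, Complex.ofReal_sub, sub_smul]
  abel

end WeylSystem

end QuantumQuad

/-! ### The optimal quadratic approximation of an observable -/

open QuantumQuad in
theorem theorem2 {n : ℕ} {ι 𝓗 : Type*} [NormedAddCommGroup 𝓗] [InnerProductSpace ℂ 𝓗]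
    [CompleteSpace 𝓗]
    (x : Fin n → 𝓗 →ₗ.[ℂ] 𝓗) (hx : ∀ j, IsSelfAdjoint (x j))
    (Θ : Matrix (Fin n) (Fin n) ℝ) (hΘ : Θ.transpose = -Θ)
    (W : (Fin n → ℝ) → 𝓗 →L[ℂ] 𝓗) (hW : QuantumQuad.IsWeylSystem x Θ W)
    (ρ : QuantumQuad.DensityOperator ι 𝓗) (hρ : ρ.IsGaussian x W)
    (hS : IsUnit (ρ.qcov x).det)
    (H : 𝓗 →ₗ.[ℂ] 𝓗) (hH : IsSelfAdjoint H) (hH2 : ρ.FiniteSecondMoment H) :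
    -- all the moments below are finite
    ((∀ j, ρ.FiniteSecondMoment (ρ.xi x j)) ∧
      (∀ j k, ρ.FiniteSecondMoment (QuantumQuad.mulOp (ρ.xi x j) (ρ.xi x k))) ∧
      ρ.FiniteSecondMoment (ρ.eta H) ∧
      (∀ α β R, ρ.FiniteSecondMoment (ρ.eta H - QuantumQuad.quadOp (ρ.xi x) α β R)) ∧
      (∀ a b R, ρ.FiniteSecondMoment (H - QuantumQuad.quadOp x a b R))) ∧
    -- `Q` is the mean square deviation of `H` from `a + bᵀ x + xᵀ R x / 2`, reparameterized
    (∀ a b, ∀ R ∈ QuantumQuad.symMats n,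
      ρ.meanSq (H - QuantumQuad.quadOp x a b R) =
        ρ.deviation x H
          (a + b ⬝ᵥ ρ.meanVec x + ρ.meanVec x ⬝ᵥ R.mulVec (ρ.meanVec x) / 2 - (ρ.expect H).re)
          (b + R.mulVec (ρ.meanVec x)) R) ∧
    -- the third-moment tensor vanishes
    (∀ j k l, ρ.tau x j k l = 0) ∧
    -- `Σ` is positive definite
    (ρ.sig x).PosDef ∧
    -- `K` is a positive definite self-adjoint operator on the symmetric matrices, and is invertible
    (∀ X ∈ QuantumQuad.symMats n, ∀ Y ∈ QuantumQuad.symMats n,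
      (X * QuantumQuad.kOp (ρ.sig x) Θ Y).trace = (QuantumQuad.kOp (ρ.sig x) Θ X * Y).trace) ∧
    (∀ R ∈ QuantumQuad.symMats n, R ≠ 0 →
      0 < (R * QuantumQuad.kOp (ρ.sig x) Θ R).trace) ∧
    Set.BijOn (QuantumQuad.kOp (ρ.sig x) Θ) (QuantumQuad.symMats n) (QuantumQuad.symMats n) ∧
    ρ.gam x H ∈ QuantumQuad.symMats n ∧
    -- the parameters that minimize `Q` are exactly the following ones
    (∀ α β, ∀ R ∈ QuantumQuad.symMats n,
      (∀ α' β', ∀ R' ∈ QuantumQuad.symMats n,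
          ρ.deviation x H α β R ≤ ρ.deviation x H α' β' R') ↔
        α = -(ρ.sig x * R).trace / 2 ∧
        β = (ρ.sig x)⁻¹.mulVec (ρ.eps x H) ∧
        R = QuantumQuad.kInv (ρ.sig x) Θ (ρ.gam x H)) := by
  obtain ⟨hmean, X, Y, hX, hY, hwick⟩ := exists_isWickFamily hx hΘ hW hρ
  obtain ⟨Φ, hΦ⟩ := hH2.exists_lifts
  have hsym : (ρ.sig x).IsSymm := DensityOperator.sig_isSymm x
  have hXY : ∀ j k, Lifts (mulOp (ρ.xi x j) (ρ.xi x k)) ρ.vacuum (Y j k) :=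
    fun j k i => (hX k i).mulOp (hY j k i)
  -- the vectors of `η`, of `η - h` and of `H - h`
  have hΩΩ : ⟪ρ.vacuum, ρ.vacuum⟫_ℂ = 1 := by
    rw [inner_self_eq_norm_sq_to_K, ρ.norm_vacuum]
    simp
  have hη := DensityOperator.lifts_centered hΦ
  set Z := Φ - ρ.expect H • ρ.vacuum with hZ
  have hZΩ : ⟪Z, ρ.vacuum⟫_ℂ = 0 := by
    rw [← inner_conj_symm, hZ, inner_sub_right, inner_smul_right, hΩΩ,
      DensityOperator.expect_eq_inner hΦ]
    simp
  have hdev : ∀ α β R, Lifts (ρ.eta H - quadOp (ρ.xi x) α β R) ρ.vacuum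
      (Z - quadVec ρ.vacuum X Y α β R) :=
    fun α β R i => (hη i).sub (lifts_quadOp hX hY α β R i)
  have hX' : ∀ j, Lifts (x j) ρ.vacuum (X j + (ρ.meanVec x j : ℂ) • ρ.vacuum) := fun j i => by
    rw [← hmean j]
    exact (hX j i).of_sub_smul_idOp
  have hY' : ∀ j k, Lifts (x j) (X k + (ρ.meanVec x k : ℂ) • ρ.vacuum)
      (Y j k + (ρ.meanVec x j : ℂ) • X k
        + (ρ.meanVec x k : ℂ) • (X j + (ρ.meanVec x j : ℂ) • ρ.vacuum)) := fun j k i => by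
    have h1 : Acts (x j) (X k i) ((Y j k + (ρ.meanVec x j : ℂ) • X k : EigenSum ι 𝓗) i) := by
      rw [← hmean j]
      exact (hY j k i).of_sub_smul_idOp
    exact h1.vec_add ((hX' j i).vec_smul (ρ.meanVec x k : ℂ))
  have hdev' : ∀ a b R, Lifts (H - quadOp x a b R) ρ.vacuum
      (Φ - quadVec ρ.vacuum (fun j => X j + (ρ.meanVec x j : ℂ) • ρ.vacuum)
        (fun j k => Y j k + (ρ.meanVec x j : ℂ) • X k
          + (ρ.meanVec x k : ℂ) • (X j + (ρ.meanVec x j : ℂ) • ρ.vacuum)) a b R) :=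
    fun a b R i => (hΦ i).sub (lifts_quadOp hX' hY' a b R i)
  -- the covariance matrix
  have hcov : ρ.qcov x = qcovMat (ρ.sig x) Θ := by
    ext j k
    rw [DensityOperator.qcov, DensityOperator.expectMul_eq_inner (hX j) (hX k), hwick.inner_X_X]
  have hpos := hwick.posDef (hcov ▸ hS)
  have hSg := posDef_of_qcovMat_posDef hsym hΘ hpos
  have hgamY : ∀ j k, (⟪Z, Y j k⟫_ℂ).re = ρ.gam x H j k := fun j k => by
    rw [DensityOperator.gam, ← DensityOperator.expectMul_eq_inner hη (hXY j k)]
    rfl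
  have heps : ∀ j, (⟪Z, X j⟫_ℂ).re = ρ.eps x H j := fun j => by
    rw [DensityOperator.eps, ← DensityOperator.expectMul_eq_inner hη (hX j)]
    rfl
  have hgam : ρ.gam x H ∈ symMats n := by
    ext j k
    rw [Matrix.transpose_apply, ← hgamY, ← hgamY, ← sub_eq_zero, ← Complex.sub_re,
      ← inner_sub_right, hwick.commutator, inner_smul_right, hZΩ]
    simp
  refine ⟨⟨fun j => DensityOperator.finiteSecondMoment_of_lifts (hX j),
    fun j k => DensityOperator.finiteSecondMoment_of_lifts (hXY j k),
    DensityOperator.finiteSecondMoment_of_lifts hη,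
    fun α β R => DensityOperator.finiteSecondMoment_of_lifts (hdev α β R),
    fun a b R => DensityOperator.finiteSecondMoment_of_lifts (hdev' a b R)⟩, ?_, ?_, hSg,
    fun X _ Y _ => trace_mul_kOp_comm X Y, fun R hR hR0 => trace_kOp_pos hsym hΘ hpos hR hR0,
    bijOn_kOp hsym hΘ hpos, hgam, ?_⟩
  · intro a b R hR
    have hreal : ((ρ.expect H).re : ℂ) = ρ.expect H := by
      rw [← Complex.conj_eq_iff_re, DensityOperator.expect_eq_inner hΦ, inner_conj_symm,
        hΦ.inner_comm hH]
    rw [DensityOperator.deviation, DensityOperator.meanSq_eq_norm_sq (hdev' a b R),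
      DensityOperator.meanSq_eq_norm_sq (hdev _ _ R), quadVec_translate _ _ _ _ _ _ hR,
      quadVec_sub_smul, hreal, hZ, sub_sub_sub_cancel_right]
  · intro j k l
    rw [DensityOperator.tau, DensityOperator.expectMul_eq_inner (hX j) (hXY k l),
      hwick.inner_X_Y, Complex.zero_re]
  · intro α β R hR
    refine isMinimizer_iff hSg hΘ hpos hgam (q := ρ.deviation x H) (c := ‖Z‖ ^ 2)
      (fun α β R hR => ?_) α β hR
    rw [DensityOperator.deviation, DensityOperator.meanSq_eq_norm_sq (hdev α β R)]
    exact hwick.norm_sub_quadVec_sq hsym hΘ hZΩ heps hgamY α β hR
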